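/- Conventions. A graph is a finite directed multigraph $G=(V,E)$ without self-loops, where $E$ is a multiset of ordered pairs $(u,v)$ with $u\ne v$ and $E\neq\emptyset$. The degree of a vertex is its in-degree plus its out-degree, counted with multiplicity. For $x:V\to\{0,1\}$ let $$\mathrm{val}_G(x)=\frac1{|E|}\,\bigl|\{(u,v)\in E : x(u)=1,\ x(v)=0\}\bigr|$$ (counted with multiplicity). The Max-DICUT value of $G$ is $\mathrm{maxval}_G=\max_{x:V\to\{0,1\}}\mathrm{val}_G(x)$. A one-pass randomized streaming algorithm is one fixed program (for all input sizes) with finitely many control states and finitely many registers holding natural numbers. It is given $n$ in one register (all others are initially $0$) and reads the stream of edges, whose endpoints are numbers below $n$, once from left to right. Its instructions are: read the next edge into two registers, or detect the end of the stream; toss a fair coin and branch on it; compare two registers and branch on the result; assign to a register a constant, a copy of a register, or the sum, truncated difference, product or integer quotient of two registers; halt and output the quotient of two registers. The space used in a configuration is the number of bits of the control state and of the binary expansions of all registers. **Theorem.** For every $D\in\mathbb N$ and every $\varepsilon>0$ there are a one-pass randomized streaming algorithm $\mathcal A$ and a constant $C$ (both depending only on $D$ and $\varepsilon$) such that the following holds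 for every $n$ and every graph $G=(\{0,\dots,n-1\},E)$ with $E\neq\emptyset$ in which every vertex has degree at most $D$. 1. For every ordering of the edges and all outcomes of the coins, $\mathcal A$ uses at most $C\log n$ bits of space throughout its run. 2. There is a $T$, which may depend on $G$, such that for every ordering of the edges and all outcomes of the coins $\mathcal A$ halts within $T$ steps. 3. If the edges of $G$ arrive in a uniformly random order, then with probability at least $99/100$ over the order and the independent coins of $\mathcal A$ the output $\hat v$ satisfies $$\Bigl(\tfrac12-\varepsilon\Bigr)\,\mathrm{maxval}_G\ \le\ \hat v\ \le\ \mathrm{maxval}_G .$$ -/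

import Mathlib

/-! ### Directed multigraphs and the maximum directed cut -/

/-- A directed multigraph without self-loops on the vertex set `V`, given by its multiset of
edges. -/
structure DiMultigraph (V : Type) where
  edges : Multiset (V × V)
  loopless : ∀ e ∈ edges, e.1 ≠ e.2

namespace DiMultigraph

section

variable {V : Type} [Fintype V] [DecidableEq V]

/-- In-degree, counted with multiplicity. -/
def inDegree (G : DiMultigraph V) (v : V) : ℕ := ∑ u : V, G.edges.count (u, v)

/-- Out-degree, counted with multiplicity. -/
def outDegree (G : DiMultigraph V) (v : V) : ℕ := ∑ u : V, G.edges.count (v, u)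

/-- Total degree. -/
def degree (G : DiMultigraph V) (v : V) : ℕ := G.outDegree v + G.inDegree v

/-- Every vertex has total degree at most `D`. -/
def MaxDegreeLE (G : DiMultigraph V) (D : ℕ) : Prop := ∀ v : V, G.degree v ≤ D

/-- The fraction of edges `(u, v)`, counted with multiplicity, with `x u = 1` and `x v = 0`.
(It is meaningful for graphs that have at least one edge.) -/
noncomputable def cutValue (G : DiMultigraph V) (x : V → Bool) : ℝ :=
  (G.edges.countP (fun e => x e.1 = true ∧ x e.2 = false) : ℝ) / (G.edges.card : ℝ)

/-- The Max-DICUT value: the maximum of the cut value over all Boolean labelings. -/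
noncomputable def maxDicut (G : DiMultigraph V) : ℝ :=
  (Finset.univ : Finset (V → Bool)).sup' Finset.univ_nonempty G.cutValue

/-- The orderings of the edge multiset: the sequences in which each edge occurs exactly as often
as its multiplicity. -/
def orderings (G : DiMultigraph V) : Finset (List (V × V)) := G.edges.lists.toFinset

end

theorem mem_orderings {V : Type} [DecidableEq V] (G : DiMultigraph V) (l : List (V × V)) :
    l ∈ G.orderings ↔ (l : Multiset (V × V)) = G.edges := by
  rw [orderings, Multiset.mem_toFinset, Multiset.mem_lists_iff]
  exact eq_comm

end DiMultigraph

/-! ### One-pass randomized streaming algorithms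

The machine model: a fixed finite control together with a fixed finite number of registers that
hold natural numbers. The edge stream is on a read-only input that is read once, from left to
right. The memory of the machine, including all of its workspace, is charged in bits. -/

/-- Right-hand sides of assignments. Subtraction is truncated, division is rounded down. -/
inductive RegExpr (Reg : Type) where
  | const (c : ℕ)
  | copy (b : Reg)
  | plus (b c : Reg)
  | minus (b c : Reg)
  | times (b c : Reg)
  | quot (b c : Reg)

/-- The value of a right-hand side, given the contents of the registers. -/
def RegExpr.value {Reg : Type} (r : Reg → ℕ) : RegExpr Reg → ℕ
  | .const c => c
  | .copy b => r b
  | .plus b c => r b + r c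
  | .minus b c => r b - r c
  | .times b c => r b * r c
  | .quot b c => r b / r c

/-- Instructions.
* `read a b next done`: if an edge `(u, v)` is left on the input, consume it, store `u` in `a`,
  then `v` in `b`, and go to `next`; at the end of the stream go to `done`.
* `toss heads tails`: toss a fair coin and go to `heads` or to `tails`.
* `branch a b yes no`: go to `yes` if the content of `a` is at most that of `b`, else to `no`.
* `assign a e next`: store the value of `e` in `a` and go to `next`.
* `halt a b`: halt with output (content of `a`) / (content of `b`). -/
inductive StreamInstr (State Reg : Type) where
  | read (a b : Reg) (next done : State)
  | toss (heads tails : State)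
  | branch (a b : Reg) (yes no : State)
  | assign (a : Reg) (e : RegExpr Reg) (next : State)
  | halt (a b : Reg)

/-- A one-pass randomized streaming algorithm: one finite program for inputs of all sizes. -/
structure StreamAlg where
  State : Type
  Reg : Type
  [fintypeState : Fintype State]
  [fintypeReg : Fintype Reg]
  [decEqReg : DecidableEq Reg]
  /-- The initial state. -/
  start : State
  /-- The register that holds the number of vertices at the beginning. -/
  sizeReg : Reg
  /-- The instruction that is executed in a given state. -/
  instr : State → StreamInstr State Reg

namespace StreamAlg

attribute [instance] fintypeState fintypeReg decEqReg

/-- A configuration: the state, the contents of the registers and the unread part of the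
stream. -/
structure Config (A : StreamAlg) where
  state : A.State
  reg : A.Reg → ℕ
  input : List (ℕ × ℕ)

/-- The initial configuration: all registers are `0`, except the one that holds the number `n` of
vertices. -/
def initial (A : StreamAlg) (n : ℕ) (s : List (ℕ × ℕ)) : A.Config where
  state := A.start
  reg := Function.update (fun _ => 0) A.sizeReg n
  input := s

/-- One step. The coin is looked at only by a `toss`. -/
def step (A : StreamAlg) (c : A.Config) (coin : Bool) : A.Config :=
  match A.instr c.state with
  | .read a b next done =>
    match c.input with
    | [] => ⟨done, c.reg, []⟩
    | (u, v) :: rest => ⟨next, Function.update (Function.update c.reg a u) b v, rest⟩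
  | .toss heads tails => ⟨if coin then heads else tails, c.reg, c.input⟩
  | .branch a b yes no => ⟨if c.reg a ≤ c.reg b then yes else no, c.reg, c.input⟩
  | .assign a e next => ⟨next, Function.update c.reg a (e.value c.reg), c.input⟩
  | .halt _ _ => c

/-- The configuration that is reached on `n` vertices and the stream `s` after as many steps as
there are coins. -/
def run (A : StreamAlg) (n : ℕ) (s : List (ℕ × ℕ)) (coins : List Bool) : A.Config :=
  coins.foldl A.step (A.initial n s)

/-- The output of a configuration; `none` if it is not halted. -/
def output (A : StreamAlg) (c : A.Config) : Option ℚ :=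
  match A.instr c.state with
  | .halt a b => some ((c.reg a : ℚ) / (c.reg b : ℚ))
  | _ => none

/-- The memory that a configuration occupies, in bits: the finite control and the binary expansions
of the register contents. -/
def space (A : StreamAlg) (c : A.Config) : ℕ :=
  Nat.clog 2 (Fintype.card A.State) + ∑ r : A.Reg, Nat.size (c.reg r)

/-- The edge stream as the machine sees it: vertices are named by the numbers `0, …, n - 1`. -/
def encode {n : ℕ} (l : List (Fin n × Fin n)) : List (ℕ × ℕ) :=
  l.map fun e => ((e.1 : ℕ), (e.2 : ℕ))

/-- On each ordering of the edges of `G`, the algorithm has halted after `T` steps, whatever the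
coins. -/
def HaltsWithin (A : StreamAlg) {n : ℕ} (G : DiMultigraph (Fin n)) (T : ℕ) : Prop :=
  ∀ l ∈ G.orderings, ∀ coins : Fin T → Bool,
    (A.output (A.run n (encode l) (List.ofFn coins))).isSome

/-- On each ordering of the edges of `G`, and whatever the coins, the memory never exceeds
`B` bits. -/
def UsesSpaceAtMost (A : StreamAlg) {n : ℕ} (G : DiMultigraph (Fin n)) (B : ℝ) : Prop :=
  ∀ l ∈ G.orderings, ∀ coins : List Bool, (A.space (A.run n (encode l) coins) : ℝ) ≤ B

open Classical in
/-- The probability, over a uniformly random ordering of the edges of `G` and independent fair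
coins, that the algorithm halts within `T` steps with an output that satisfies `P`. -/
noncomputable def randomOrderProb (A : StreamAlg) {n : ℕ} (G : DiMultigraph (Fin n)) (T : ℕ)
    (P : ℚ → Prop) : ℝ :=
  (((G.orderings ×ˢ (Finset.univ : Finset (Fin T → Bool))).filter fun p =>
      ∃ q, A.output (A.run n (encode p.1) (List.ofFn p.2)) = some q ∧ P q).card : ℝ) /
    ((G.orderings ×ˢ (Finset.univ : Finset (Fin T → Bool))).card : ℝ)

end StreamAlg

/-!
The optimum of the linear relaxation, which maximizes the sum over the edges `(u, v)` of
`min (x u) (1 - x v)` over `x` with values in `[0, 1]`, lies between the maximum directed cut and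
twice the maximum directed cut: labelling `v` with `1` independently with probability
`1 / 4 + x v / 2` cuts each edge with probability at least half of its term (`relaxation_le`). It
therefore suffices to estimate this optimum, divided by the number `m` of edges, up to a small
additive error, which is also a small relative error because a quarter of the edges can always be
cut (`card_div_four_le`).

The optimum is approximated by a bounded number `T` of rounds of projected supergradient ascent
from `0` (`cutCount_le_sum_reward`). The ascent is local: the contribution of an edge `a` to the
value, its `reward`, depends only on the edges within distance `T` of `a`. The quantity to be
estimated is the average reward of an edge.

The reward of the root `a`, as a function of the set of the other edges, is the sum over the
subsets of its Möbius transform (`sum_coeff`), which vanishes on sets that are not contained in the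
neighbourhood of `a` or not connected to it. Such a set can be listed so that each edge touches an
earlier one or the root, and in a uniformly random order it is listed in this way with a positive
probability that depends only on its isomorphism type. Giving each sequence that grows from the
root the Möbius coefficient divided by this probability yields an unbiased estimate of the reward
from the sequences that one actually sees growing (`sum_observed_mul`). To see them it suffices to
retain the edges that extend a short growing sequence, and the bound on the degrees bounds the
number of retained edges (`estimate_retain`, `length_retain_lt`).

The first `s` edges of the stream serve as roots. What is seen from two distant roots is
independent, since permuting the edges in the neighbourhood of one of them leaves the other one
alone (`sum_order_mul`, `sum_observed_far`), and most pairs of roots are distant. Chebyshev's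
inequality then gives concentration (`card_deviation_le`). If there are fewer than `s` edges, all
of them are retained and the average reward is computed exactly.

The resulting rule retains boundedly many edges and is invariant under renaming of vertices, so
finitely many registers for vertex names and a finite control suffice to run it
(`EdgeFilter.exists_streamAlg`). No coins are used; all randomness is in the order of the edges.
-/

/-! ### Finite-memory edge filters as streaming algorithms -/

/-- Renaming the endpoints of an edge. -/
abbrev relabel {α β : Type} (φ : α → β) : α × α → β × β := Prod.map φ φ

open Classical in
/-- The list of edges that are retained from a stream `s` by the rule `keep`, which decides on each
new edge in view of the edges retained so far. -/
noncomputable def retain (keep : List (ℕ × ℕ) → ℕ × ℕ → Prop) (s : List (ℕ × ℕ)) :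
    List (ℕ × ℕ) :=
  s.foldl (fun l e => if keep l e then l ++ [e] else l) []

namespace StreamAlg

variable {A : StreamAlg}

/-- From `c` the algorithm gets to `c'`, in a number of steps that does not depend on the coins. -/
def Reaches (A : StreamAlg) (c c' : A.Config) : Prop :=
  ∃ k, ∀ coins : List Bool, coins.length = k → coins.foldl A.step c = c'

theorem Reaches.refl (c : A.Config) : A.Reaches c c :=
  ⟨0, fun coins h => by rw [List.length_eq_zero_iff.1 h]; rfl⟩

theorem Reaches.trans {c₁ c₂ c₃ : A.Config} (h : A.Reaches c₁ c₂) (h' : A.Reaches c₂ c₃) :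
    A.Reaches c₁ c₃ := by
  obtain ⟨k, hk⟩ := h
  obtain ⟨k', hk'⟩ := h'
  refine ⟨k + k', fun coins hc => ?_⟩
  rw [← List.take_append_drop k coins, List.foldl_append, hk _ (by simp [hc]),
    hk' _ (by simp [hc])]

theorem Reaches.head {c₁ c₂ c₃ : A.Config} (h : ∀ coin, A.step c₁ coin = c₂)
    (h' : A.Reaches c₂ c₃) : A.Reaches c₁ c₃ := by
  refine Reaches.trans ⟨1, fun coins hc => ?_⟩ h'
  obtain ⟨x, rfl⟩ := List.length_eq_one_iff.1 hc
  exact h x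

theorem Reaches.output_eq {c c' : A.Config} (h : A.Reaches c c') {q : ℚ}
    (hq : A.output c' = some q) :
    ∃ k, ∀ coins : List Bool, k ≤ coins.length → A.output (coins.foldl A.step c) = some q := by
  obtain ⟨k, hk⟩ := h
  refine ⟨k, fun coins hc => ?_⟩
  have hfix : ∀ coin, A.step c' coin = c' := by
    intro coin
    unfold output at hq
    unfold step
    split at hq <;> simp_all
  have hfold : ∀ coins : List Bool, coins.foldl A.step c' = c' := by
    intro coins
    induction coins with
    | nil => rfl
    | cons x xs ih => rw [List.foldl_cons, hfix, ih]
  rw [← List.take_append_drop k coins, List.foldl_append, hk _ (by simp [hc]), hfold, hq]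

/-- The algorithm never computes anything larger than `B`: it only copies registers and assigns
constants that are at most `B`. -/
def CopiesOnly (A : StreamAlg) (B : ℕ) : Prop :=
  ∀ s a e t, A.instr s = .assign a e t → (∃ b, e = .copy b) ∨ ∃ k, k ≤ B ∧ e = .const k

theorem CopiesOnly.reg_le {B : ℕ} (hA : A.CopiesOnly B) (coins : List Bool) (c : A.Config)
    (hc : (∀ r, c.reg r ≤ B) ∧ ∀ e ∈ c.input, e.1 ≤ B ∧ e.2 ≤ B) :
    ∀ r, (coins.foldl A.step c).reg r ≤ B := by
  induction coins generalizing c with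
  | nil => exact hc.1
  | cons x xs ih =>
    rw [List.foldl_cons]
    refine ih _ ?_
    obtain ⟨h1, h2⟩ := hc
    have hupd : ∀ (f : A.Reg → ℕ) (a : A.Reg) (v : ℕ), (∀ r, f r ≤ B) → v ≤ B →
        ∀ r, Function.update f a v r ≤ B := by
      intro f a v hf hv r
      by_cases hr : r = a
      · subst hr; simpa using hv
      · simpa [Function.update_of_ne hr] using hf r
    unfold step
    split
    · split
      · exact ⟨h1, by simp⟩
      · next u v rest heq =>
        rw [heq] at h2
        have huv := h2 (u, v) (by simp)
        exact ⟨hupd _ _ _ (hupd _ _ _ h1 huv.1) huv.2, fun e he => h2 e (by simp [he])⟩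
    · exact ⟨h1, h2⟩
    · exact ⟨h1, h2⟩
    · next a e t heq =>
      refine ⟨hupd _ _ _ h1 ?_, h2⟩
      rcases hA _ _ _ _ heq with ⟨b, rfl⟩ | ⟨k, hk, rfl⟩
      · exact h1 b
      · exact hk
    · exact ⟨h1, h2⟩

theorem size_add_le (n k : ℕ) : Nat.size (n + k) ≤ Nat.size n + k := by
  rw [Nat.size_le, pow_add]
  have h1 : n < 2 ^ Nat.size n := Nat.lt_size_self n
  have h2 : k < 2 ^ k := Nat.lt_two_pow_self
  nlinarith

theorem size_le_log {n : ℕ} (hn : 2 ≤ n) : (Nat.size n : ℝ) ≤ 2 / Real.log 2 * Real.log n := by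
  have hlog : 0 < Real.log 2 := Real.log_pos (by norm_num)
  have h0 : 0 < Nat.size n := Nat.size_pos.2 (by omega)
  have h1 : 2 ^ (Nat.size n - 1) ≤ n := Nat.lt_size.1 (by omega)
  have h2 : ((Nat.size n - 1 : ℕ) : ℝ) * Real.log 2 ≤ Real.log n := by
    rw [← Real.log_pow]
    exact Real.log_le_log (by positivity) (by exact_mod_cast h1)
  have h3 : Real.log 2 ≤ Real.log n := Real.log_le_log (by norm_num) (by exact_mod_cast hn)
  rw [Nat.cast_sub h0] at h2
  rw [div_mul_eq_mul_div, le_div_iff₀ hlog]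
  push_cast at h2
  nlinarith

/-- An algorithm that only copies vertex names and constants uses logarithmic space. -/
theorem CopiesOnly.space_le {k : ℕ} (hA : ∀ n, A.CopiesOnly (n + k)) :
    ∃ C : ℝ, ∀ n, 2 ≤ n → ∀ s : List (ℕ × ℕ), (∀ e ∈ s, e.1 < n ∧ e.2 < n) →
      ∀ coins, (A.space (A.run n s coins) : ℝ) ≤ C * Real.log n := by
  have hlog : 0 < Real.log 2 := Real.log_pos (by norm_num)
  refine ⟨(Nat.clog 2 (Fintype.card A.State) + Fintype.card A.Reg * (k + 2)) / Real.log 2,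
    fun n hn s hs coins => ?_⟩
  have hreg := (hA n).reg_le coins (A.initial n s) (by
    refine ⟨fun r => ?_, fun e he => ⟨?_, ?_⟩⟩
    · by_cases hr : r = A.sizeReg
      · subst hr; simp [initial]
      · simp [initial, Function.update_of_ne hr]
    · exact (hs e he).1.le.trans (Nat.le_add_right _ _)
    · exact (hs e he).2.le.trans (Nat.le_add_right _ _))
  have hsum : A.space (A.run n s coins) ≤
      Nat.clog 2 (Fintype.card A.State) + Fintype.card A.Reg * (Nat.size n + k) := by
    unfold space
    refine Nat.add_le_add_left ?_ _
    refine (Finset.sum_le_card_nsmul _ _ (Nat.size n + k) fun r _ => ?_).trans (by simp)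
    exact (Nat.size_le_size (hreg r)).trans (size_add_le n k)
  have h3 : Real.log 2 ≤ Real.log n := Real.log_le_log (by norm_num) (by exact_mod_cast hn)
  have h1 : (1 : ℝ) ≤ Real.log n / Real.log 2 := (one_le_div hlog).2 h3
  have h2 := size_le_log hn
  calc (A.space (A.run n s coins) : ℝ)
      ≤ Nat.clog 2 (Fintype.card A.State) + Fintype.card A.Reg * (Nat.size n + k) := by
        exact_mod_cast hsum
    _ ≤ Nat.clog 2 (Fintype.card A.State) * (Real.log n / Real.log 2)
        + Fintype.card A.Reg * (2 / Real.log 2 * Real.log n + k * (Real.log n / Real.log 2)) := by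
        gcongr
        · exact le_mul_of_one_le_right (by positivity) h1
        · exact le_mul_of_one_le_right (by positivity) h1
    _ = _ := by field_simp; ring

end StreamAlg

/-! ### The machine that runs an edge filter -/

namespace EdgeFilter

/-- What the machine is about to do. -/
inductive Phase
  | read
  | le
  | ge
  | num
  | den
  | done
  deriving DecidableEq

instance : Fintype Phase :=
  ⟨{.read, .le, .ge, .num, .den, .done}, fun p => by cases p <;> simp⟩

section

variable (K : ℕ)

/-- The indices of the registers for vertex names: two for each retained edge, and two spare ones so
that there is room for the endpoints of a new edge. -/
abbrev Slot : Type := Fin (2 * K + 2)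

/-- The retained edges, written with the registers that hold their endpoints. -/
abbrev Memory : Type := {c : List (Slot K × Slot K) // c.length ≤ K}

noncomputable instance : Fintype (Memory K) := (List.finite_length_le _ K).fintype

/-- The control state: the retained edges, the slot of the first endpoint of the current edge once
it is known, the slots that still have to be compared with the current vertex, and the phase. -/
abbrev Control : Type := Memory K × Option (Slot K) × Finset (Slot K) × Phase

/-- The registers: the slots, and two for the endpoints of the current edge. -/
abbrev Register : Type := Slot K ⊕ Bool

variable {K}

/-- The slots that are in use. -/
def used (c : Memory K) (o : Option (Slot K)) : Finset (Slot K) :=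
  (c.1.map Prod.fst).toFinset ∪ (c.1.map Prod.snd).toFinset ∪ o.toFinset

theorem mem_used {c : Memory K} {o : Option (Slot K)} {j : Slot K} :
    j ∈ used c o ↔ (∃ e ∈ c.1, e.1 = j) ∨ (∃ e ∈ c.1, e.2 = j) ∨ o = some j := by
  simp [used]

theorem exists_notMem_used (c : Memory K) (o : Option (Slot K)) : ∃ j, j ∉ used c o := by
  by_contra! h
  have h1 : (used c o).card = 2 * K + 2 := by
    rw [Finset.eq_univ_iff_forall.2 h]; simp
  have h2 : (used c o).card ≤ K + K + 1 := by
    refine (Finset.card_union_le _ _).trans (Nat.add_le_add ((Finset.card_union_le _ _).trans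
      (Nat.add_le_add ?_ ?_)) ?_)
    · exact (List.toFinset_card_le _).trans (by simpa using c.2)
    · exact (List.toFinset_card_le _).trans (by simpa using c.2)
    · cases o <;> simp
  omega

/-- A slot that is not in use. -/
noncomputable def fresh (c : Memory K) (o : Option (Slot K)) : Slot K :=
  (exists_notMem_used c o).choose

theorem fresh_notMem (c : Memory K) (o : Option (Slot K)) : fresh c o ∉ used c o :=
  (exists_notMem_used c o).choose_spec

/-- The register of the endpoint that is being looked for. -/
def target (o : Option (Slot K)) : Register K := .inr o.isSome

/-- The retained edges, with the slots regarded as vertex names. -/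
def edges (c : Memory K) : List (ℕ × ℕ) := c.1.map (relabel Fin.val)

variable (keep : List (ℕ × ℕ) → ℕ × ℕ → Prop) (out : List (ℕ × ℕ) → ℚ)

open Classical in
/-- The memory after the edge with endpoints in the slots `e` has been read. -/
noncomputable def extend (c : Memory K) (e : Slot K × Slot K) : Memory K :=
  if h : c.1.length < K ∧ keep (edges c) (relabel Fin.val e) then
    ⟨c.1 ++ [e], by simpa using h.1⟩ else c

/-- The control state after the current endpoint has been found in the slot `p`. -/
noncomputable def found (c : Memory K) : Option (Slot K) → Slot K → Control K
  | none, p => (c, some p, used c (some p), .le)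
  | some q, p => (extend keep c (q, p), none, ∅, .read)

/-- The program. The phases `le` and `ge` compare the current endpoint with one slot after the
other, until it is found or known to be new. Phase `ge` is never entered with an empty set of slots
to compare, so its `halt` is not reached. -/
noncomputable def program : Control K → StreamInstr (Control K) (Register K)
  | (c, _, _, .read) =>
    .read (.inr false) (.inr true) (c, none, used c none, .le) (c, none, ∅, .num)
  | (c, o, S, .le) =>
    if h : S.Nonempty then
      .branch (.inl h.choose) (target o) (c, o, S, .ge) (c, o, S.erase h.choose, .le)
    else .assign (.inl (fresh c o)) (.copy (target o)) (found keep c o (fresh c o))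
  | (c, o, S, .ge) =>
    if h : S.Nonempty then
      .branch (target o) (.inl h.choose) (found keep c o h.choose) (c, o, S.erase h.choose, .le)
    else .halt (.inr false) (.inr true)
  | (c, _, _, .num) =>
    .assign (.inr false) (.const (out (edges c)).num.toNat) (c, none, ∅, .den)
  | (c, _, _, .den) => .assign (.inr true) (.const (out (edges c)).den) (c, none, ∅, .done)
  | (_, _, _, .done) => .halt (.inr false) (.inr true)

variable (K) in
/-- The streaming algorithm that retains edges by the rule `keep` and outputs the value of `out`
at the retained edges. -/
noncomputable abbrev alg : StreamAlg where
  State := Control K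
  Reg := Register K
  start := (⟨[], Nat.zero_le _⟩, none, ∅, .read)
  sizeReg := .inr false
  instr := program keep out

/-- The slots in use hold different vertices. Two occurrences of the same vertex then have the same
slot, so that the control state determines the retained edges up to renaming. -/
def Faithful (c : Memory K) (o : Option (Slot K)) (reg : Register K → ℕ) : Prop :=
  Set.InjOn (fun j => reg (.inl j)) (used c o : Set (Slot K))

/-- The comparisons find the current endpoint in a slot, or put it into a new one. -/
theorem reaches_found (c : Memory K) (o : Option (Slot K)) (S : Finset (Slot K))
    (reg : Register K → ℕ) (input : List (ℕ × ℕ)) (hS : S ⊆ used c o)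
    (hreg : Faithful c o reg)
    (hne : ∀ j ∈ used c o, j ∉ S → reg (.inl j) ≠ reg (target o)) :
    ∃ (p : Slot K) (reg' : Register K → ℕ), (alg K keep out).Reaches ⟨(c, o, S, .le), reg, input⟩
        ⟨found keep c o p, reg', input⟩ ∧
      (∀ r, (∀ j ∉ used c o, r ≠ .inl j) → reg' r = reg r) ∧
      reg' (.inl p) = reg (target o) ∧
      ∀ j ∈ used c o, reg' (.inl j) = reg (target o) → j = p := by
  induction hk : S.card using Nat.strong_induction_on generalizing S with
  | _ k ih =>
  by_cases h : S.Nonempty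
  · set j := h.choose with hj
    have hjS : j ∈ S := h.choose_spec
    by_cases hle : reg (.inl j) = reg (target o)
    · refine ⟨j, reg, ?_, fun _ _ => rfl, hle,
        fun i hi hi' => hreg hi (hS hjS) (hi'.trans hle.symm)⟩
      refine .head (c₂ := ⟨(c, o, S, .ge), reg, input⟩) (fun coin => ?_)
        (.head (c₂ := ⟨found keep c o j, reg, input⟩) (fun coin => ?_) (.refl _))
      · simp [StreamAlg.step, alg, program, h, ← hj, hle]
      · simp [StreamAlg.step, alg, program, h, ← hj, hle]
    · obtain ⟨p, reg', h1, h2⟩ := ih _ (hk ▸ Finset.card_erase_lt_of_mem hjS) (S.erase j)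
        ((Finset.erase_subset _ _).trans hS) (by
          intro i hi hi'
          by_cases hij : i = j
          · exact hij ▸ hle
          · exact hne i hi fun hiS => hi' (Finset.mem_erase.2 ⟨hij, hiS⟩)) rfl
      refine ⟨p, reg', ?_, h2⟩
      by_cases hlt : reg (.inl j) ≤ reg (target o)
      · refine .head (c₂ := ⟨(c, o, S, .ge), reg, input⟩) (fun coin => ?_)
          (.head (fun coin => ?_) h1)
        · simp [StreamAlg.step, alg, program, h, ← hj, hlt]
        · have : ¬ reg (target o) ≤ reg (.inl j) := fun h' => hle (le_antisymm hlt h')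
          simp [StreamAlg.step, alg, program, h, ← hj, this]
      · refine .head (fun coin => ?_) h1
        simp [StreamAlg.step, alg, program, h, ← hj, hlt]
  · obtain rfl := Finset.not_nonempty_iff_eq_empty.1 h
    refine ⟨fresh c o, Function.update reg (.inl (fresh c o)) (reg (target o)),
      .head (fun coin => ?_) (.refl _), fun r hr => ?_, by simp, fun j hj hj' => ?_⟩
    · simp [StreamAlg.step, alg, program, RegExpr.value]
    · exact Function.update_of_ne (hr _ (fresh_notMem c o)) _ _
    · have hne' : j ≠ fresh c o := fun h' => fresh_notMem c o (h' ▸ hj)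
      rw [Function.update_of_ne (by simpa using hne')] at hj'
      exact absurd hj' (hne j hj (by simp))

variable {keep out}

/-- An injection on a finite set of numbers extends to an injection on all numbers. -/
theorem exists_injective_extension {N : ℕ} (ψ : Fin N → ℕ) (U : Finset (Fin N))
    (h : Set.InjOn ψ U) :
    ∃ φ : ℕ → ℕ, Function.Injective φ ∧ ∀ j ∈ U, φ j = ψ j := by
  classical
  refine ⟨fun i => if hi : ∃ j ∈ U, (j : ℕ) = i then ψ hi.choose else
    i + (U.sup ψ + 1), fun a b hab => ?_, fun j hj => ?_⟩
  · have hsup : ∀ i (hi : ∃ j ∈ U, (j : ℕ) = i), ψ hi.choose ≤ U.sup ψ := fun i hi =>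
      Finset.le_sup hi.choose_spec.1
    dsimp only at hab
    split_ifs at hab with ha hb hb
    · have := h ha.choose_spec.1 hb.choose_spec.1 hab
      rw [← ha.choose_spec.2, ← hb.choose_spec.2, this]
    · have := hsup a ha; omega
    · have := hsup b hb; omega
    · omega
  · have hi : ∃ j' ∈ U, (j' : ℕ) = j := ⟨j, hj, rfl⟩
    simp only [hi, dif_pos]
    rw [Fin.val_injective hi.choose_spec.2]

/-- The names of the retained edges that the registers stand for. -/
def contents (c : Memory K) (reg : Register K → ℕ) : List (ℕ × ℕ) :=
  c.1.map (relabel fun j => reg (.inl j))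

theorem contents_eq_map {c : Memory K} {o : Option (Slot K)} {reg : Register K → ℕ}
    {φ : ℕ → ℕ} (hφ : ∀ j ∈ used c o, φ j = reg (.inl j)) :
    contents c reg = (edges c).map (relabel φ) := by
  rw [contents, edges, List.map_map]
  refine List.map_congr_left fun e he => ?_
  refine Prod.ext ?_ ?_
  · exact (hφ _ (mem_used.2 (.inl ⟨e, he, rfl⟩))).symm
  · exact (hφ _ (mem_used.2 (.inr (.inl ⟨e, he, rfl⟩)))).symm

/-- Processing one edge of the stream. -/
theorem reaches_next (hcap : ∀ l e, keep l e → l.length < K)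
    (hkeep : ∀ φ : ℕ → ℕ, Function.Injective φ → ∀ l e,
      keep (l.map (relabel φ)) (relabel φ e) ↔ keep l e)
    (c : Memory K) (o : Option (Slot K)) (S : Finset (Slot K)) (reg : Register K → ℕ)
    (e : ℕ × ℕ) (input : List (ℕ × ℕ)) (hreg : Faithful c none reg) :
    ∃ (c' : Memory K) (reg' : Register K → ℕ),
      (alg K keep out).Reaches ⟨(c, o, S, .read), reg, e :: input⟩
        ⟨(c', none, ∅, .read), reg', input⟩ ∧ Faithful c' none reg' ∧
      contents c' reg' =
        (open Classical in if keep (contents c reg) e then contents c reg ++ [e]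
          else contents c reg) := by
  classical
  set reg₀ : Register K → ℕ :=
    Function.update (Function.update reg (.inr false) e.1) (.inr true) e.2 with hreg₀
  have h0 : ∀ j, reg₀ (.inl j) = reg (.inl j) := fun j => by simp [hreg₀]
  obtain ⟨p, reg₁, hreach₁, heq₁, hp, huniq₁⟩ := reaches_found keep out c none (used c none) reg₀
    input (le_refl _) (fun i hi j hj hij => hreg hi hj (by simpa [h0] using hij))
    (fun j hj hj' => absurd hj hj')
  have hreg₁ : Faithful c (some p) reg₁ := by
    have hmem : ∀ j, j ∈ used c (some p) ↔ j ∈ used c none ∨ j = p := by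
      intro j; simp [mem_used, or_assoc, eq_comm]
    have hold : ∀ j ∈ used c none, reg₁ (.inl j) = reg (.inl j) := by
      intro j hj
      rw [← h0]
      exact heq₁ _ fun i hi hij => hi (by simpa using (Sum.inl.inj hij) ▸ hj)
    intro i hi j hj hij
    rw [Finset.mem_coe, hmem] at hi hj
    dsimp only at hij
    rcases hi with hi | rfl <;> rcases hj with hj | rfl
    · exact hreg hi hj (by simpa [hold i hi, hold j hj] using hij)
    · exact huniq₁ i hi (hij.trans hp)
    · exact (huniq₁ j hj (hij.symm.trans hp)).symm
    · rfl
  obtain ⟨q, reg₂, hreach₂, heq₂, hq, huniq₂⟩ := reaches_found keep out c (some p)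
    (used c (some p)) reg₁ input (le_refl _) hreg₁ (fun j hj hj' => absurd hj hj')
  have hsub : ∀ j ∈ used c none, j ∈ used c (some p) := by
    intro j; rw [mem_used, mem_used]; simp only [reduceCtorEq, or_false]
    exact fun h => h.elim .inl fun h => .inr (.inl h)
  have hpmem : p ∈ used c (some p) := by simp [mem_used]
  have hold₂ : ∀ j ∈ used c (some p), reg₂ (.inl j) = reg₁ (.inl j) := fun j hj =>
    heq₂ _ fun i hi hij => hi ((Sum.inl.inj hij) ▸ hj)
  have hold : ∀ j ∈ used c none, reg₂ (.inl j) = reg (.inl j) := by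
    intro j hj
    rw [hold₂ j (hsub j hj), ← h0]
    exact heq₁ _ fun i hi hij => hi ((Sum.inl.inj hij) ▸ hj)
  have hp' : reg₂ (.inl p) = e.1 := by
    rw [hold₂ p hpmem, hp]; simp [target, hreg₀]
  have hq' : reg₂ (.inl q) = e.2 := by
    rw [hq, heq₁ _ (by simp [target])]; simp [target, hreg₀]
  set U : Finset (Slot K) := insert q (used c (some p)) with hU
  have hinj : Set.InjOn (fun j => reg₂ (.inl j)) (U : Set (Slot K)) := by
    intro i hi j hj hij
    rw [Finset.mem_coe, hU, Finset.mem_insert] at hi hj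
    dsimp only at hij
    rcases hi with rfl | hi <;> rcases hj with rfl | hj
    · rfl
    · exact (huniq₂ j hj (hij.symm.trans hq)).symm
    · exact huniq₂ i hi (hij.trans hq)
    · rw [hold₂ i hi, hold₂ j hj] at hij
      exact hreg₁ hi hj hij
  -- the slots stand for the vertices through an injective renaming, so `keep` gives the same answer
  -- for slots and for vertices
  obtain ⟨φ, hφ, hφU⟩ := exists_injective_extension _ U hinj
  have hcont : contents c reg = contents c reg₂ := by
    rw [contents, contents]
    refine List.map_congr_left fun f hf => Prod.ext ?_ ?_
    · exact (hold _ (mem_used.2 (.inl ⟨f, hf, rfl⟩))).symm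
    · exact (hold _ (mem_used.2 (.inr (.inl ⟨f, hf, rfl⟩)))).symm
  have hφc : contents c reg = (edges c).map (relabel φ) := by
    rw [hcont]
    exact contents_eq_map (o := none) fun j hj =>
      hφU j (Finset.mem_insert_of_mem (hsub j hj))
  have hφe : e = relabel φ (relabel Fin.val (p, q)) := by
    refine Prod.ext ?_ ?_
    · exact hp'.symm.trans (hφU p (Finset.mem_insert_of_mem hpmem)).symm
    · exact hq'.symm.trans (hφU q (Finset.mem_insert_self _ _)).symm
  have hkeepiff : keep (contents c reg) e ↔ keep (edges c) (relabel Fin.val (p, q)) := by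
    rw [hφc, hφe]; exact hkeep φ hφ _ _
  refine ⟨extend keep c (p, q), reg₂, ?_, ?_, ?_⟩
  · refine .head (c₂ := ⟨(c, none, used c none, .le), reg₀, input⟩) (fun coin => ?_)
      (hreach₁.trans hreach₂)
    simp [StreamAlg.step, alg, program, hreg₀]
  · refine hinj.mono fun j hj => ?_
    rw [Finset.mem_coe, mem_used] at hj
    rw [Finset.mem_coe, hU, Finset.mem_insert, mem_used]
    unfold extend at hj
    split_ifs at hj with h
    · simp only [List.mem_append, List.mem_singleton] at hj
      rcases hj with ⟨f, hf | rfl, rfl⟩ | ⟨f, hf | rfl, rfl⟩ | hj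
      · exact .inr (.inl ⟨f, hf, rfl⟩)
      · exact .inr (.inr (.inr rfl))
      · exact .inr (.inr (.inl ⟨f, hf, rfl⟩))
      · exact .inl rfl
      · simp at hj
    · rcases hj with hj | hj | hj
      · exact .inr (.inl hj)
      · exact .inr (.inr (.inl hj))
      · simp at hj
  · by_cases hk : keep (contents c reg) e
    · have hlen : c.1.length < K := by simpa [contents] using hcap _ _ hk
      rw [if_pos hk, extend, dif_pos ⟨hlen, hkeepiff.1 hk⟩]
      simp only [hcont]
      simp [contents, hp', hq']
    · rw [if_neg hk, extend, dif_neg fun h => hk (hkeepiff.2 h.2), hcont]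

/-- Processing the whole stream. -/
theorem reaches_done (hcap : ∀ l e, keep l e → l.length < K)
    (hkeep : ∀ φ : ℕ → ℕ, Function.Injective φ → ∀ l e,
      keep (l.map (relabel φ)) (relabel φ e) ↔ keep l e)
    (s : List (ℕ × ℕ)) (c : Memory K) (reg : Register K → ℕ) (hreg : Faithful c none reg) :
    ∃ (c' : Memory K) (reg' : Register K → ℕ),
      (alg K keep out).Reaches ⟨(c, none, ∅, .read), reg, s⟩
        ⟨(c', none, ∅, .num), reg', []⟩ ∧ Faithful c' none reg' ∧
      contents c' reg' = (open Classical in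
        s.foldl (fun l e => if keep l e then l ++ [e] else l) (contents c reg)) := by
  induction s generalizing c reg with
  | nil =>
    refine ⟨c, reg, .head (fun coin => ?_) (.refl _), hreg, rfl⟩
    simp [StreamAlg.step, alg, program]
  | cons e s ih =>
    obtain ⟨c₁, reg₁, h1, h2, h3⟩ := reaches_next (out := out) hcap hkeep c none ∅ reg e s hreg
    obtain ⟨c₂, reg₂, h4, h5, h6⟩ := ih c₁ reg₁ h2
    refine ⟨c₂, reg₂, h1.trans h4, h5, ?_⟩
    rw [h6, List.foldl_cons, h3]

theorem output_done (c : Memory K) (reg : Register K → ℕ) (hnn : ∀ l, 0 ≤ out l) :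
    ∃ c', (alg K keep out).Reaches ⟨(c, none, ∅, .num), reg, []⟩ c' ∧
      (alg K keep out).output c' = some (out (edges c)) := by
  refine ⟨_, .head (fun coin => rfl) (.head (fun coin => rfl) (.refl _)), ?_⟩
  have hnum : (((out (edges c)).num.toNat : ℕ) : ℚ) = (out (edges c)).num := by
    exact_mod_cast Int.toNat_of_nonneg (Rat.num_nonneg.2 (hnn _))
  simp [StreamAlg.output, alg, program, RegExpr.value, hnum, Rat.num_div_den]

/-- The only constants in the program are numerators and denominators of the finitely many
possible outputs. -/
theorem copiesOnly : ∃ k, ∀ n, (alg K keep out).CopiesOnly (n + k) := by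
  classical
  refine ⟨(Finset.univ : Finset (Memory K)).sup fun c =>
    (out (edges c)).num.toNat + (out (edges c)).den, fun n s a e t h => ?_⟩
  have hsup : ∀ c : Memory K, (out (edges c)).num.toNat + (out (edges c)).den ≤ _ := fun c =>
    Finset.le_sup (f := fun c : Memory K => (out (edges c)).num.toNat + (out (edges c)).den)
      (Finset.mem_univ c)
  obtain ⟨c, o, S, ph⟩ := s
  have hc := hsup c
  cases ph
  · simp [alg, program] at h
  · simp only [alg, program] at h
    split_ifs at h
    simp only [StreamInstr.assign.injEq] at h
    exact .inl ⟨_, h.2.1.symm⟩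
  · simp only [alg, program] at h
    split_ifs at h
  · simp only [alg, program, StreamInstr.assign.injEq] at h
    exact .inr ⟨_, by omega, h.2.1.symm⟩
  · simp only [alg, program, StreamInstr.assign.injEq] at h
    exact .inr ⟨_, by omega, h.2.1.symm⟩
  · simp [alg, program] at h

end

/-- **Compilation.** A rule that retains boundedly many edges and an output that depends on the
retained edges, both invariant under renaming of vertices, are carried out by a streaming algorithm
in logarithmic space, without using its coins. -/
theorem exists_streamAlg (K : ℕ) (keep : List (ℕ × ℕ) → ℕ × ℕ → Prop)
    (out : List (ℕ × ℕ) → ℚ) (hcap : ∀ l e, keep l e → l.length < K)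
    (hkeep : ∀ φ : ℕ → ℕ, Function.Injective φ → ∀ l e,
      keep (l.map (relabel φ)) (relabel φ e) ↔ keep l e)
    (hout : ∀ φ : ℕ → ℕ, Function.Injective φ → ∀ l, out (l.map (relabel φ)) = out l)
    (hnn : ∀ l, 0 ≤ out l) :
    ∃ (A : StreamAlg) (C : ℝ), ∀ n, 2 ≤ n → ∀ s : List (ℕ × ℕ),
      (∀ e ∈ s, e.1 < n ∧ e.2 < n) →
        (∀ coins, (A.space (A.run n s coins) : ℝ) ≤ C * Real.log n) ∧
        ∃ T, ∀ coins : List Bool, T ≤ coins.length →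
          A.output (A.run n s coins) = some (out (retain keep s)) := by
  obtain ⟨k, hk⟩ := copiesOnly (K := K) (keep := keep) (out := out)
  obtain ⟨C, hC⟩ := StreamAlg.CopiesOnly.space_le hk
  refine ⟨alg K keep out, C, fun n hn s hs => ⟨hC n hn s hs, ?_⟩⟩
  obtain ⟨c, reg, h1, h2, h3⟩ := reaches_done (out := out) hcap hkeep s ⟨[], Nat.zero_le _⟩
    (Function.update (fun _ => 0) (.inr false) n) (by
      intro i hi
      rw [Finset.mem_coe, mem_used] at hi
      simp at hi)
  obtain ⟨c', h4, h5⟩ := output_done (keep := keep) c reg hnn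
  obtain ⟨φ, hφ, hφU⟩ := exists_injective_extension _ (used c none) h2
  have h6 : out (retain keep s) = out (edges c) := by
    rw [← hout φ hφ (edges c), ← contents_eq_map (reg := reg) hφU, h3]
    rfl
  rw [h6]
  exact (h1.trans h4).output_eq h5

end EdgeFilter

namespace RandomOrderDicut

/-! ### Projected supergradient ascent for the linear relaxation -/

section Ascent

/-- A supergradient of the concave function `x ↦ min (x u) (1 - x v)` of the edge `e = (u, v)`, as a
function of the vertex; where the two terms agree, that of `x u` is taken. -/
def push (x : ℕ → ℚ) (e : ℕ × ℕ) (v : ℕ) : ℚ :=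
  if x e.1 + x e.2 ≤ 1 then (if v = e.1 then 1 else 0) else (if v = e.2 then -1 else 0)

/-- One step of projected supergradient ascent with step size `η` for the sum over the edges
`(u, v)` in `l` of `min (x u) (1 - x v)`, on the cube `[0, 1] ^ ℕ`. -/
def ascend (η : ℚ) (l : List (ℕ × ℕ)) (x : ℕ → ℚ) (v : ℕ) : ℚ :=
  max 0 (min 1 (x v + η * (l.map fun e => push x e v).sum))

/-- The iterates of the ascent, started at `0`. -/
def iterate (η : ℚ) (l : List (ℕ × ℕ)) : ℕ → ℕ → ℚ
  | 0 => fun _ => 0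
  | t + 1 => ascend η l (iterate η l t)

/-- The contribution of the edge `e` to the value of the average iterate: the average of
`min (x u) (1 - x v)` over the first `T` iterates `x`. -/
def reward (η : ℚ) (T : ℕ) (l : List (ℕ × ℕ)) (e : ℕ × ℕ) : ℚ :=
  (∑ t ∈ Finset.range T, min (iterate η l t e.1) (1 - iterate η l t e.2)) / T

variable {η : ℚ} {T : ℕ}

theorem iterate_nonneg (l : List (ℕ × ℕ)) (t v : ℕ) : 0 ≤ iterate η l t v := by
  cases t with
  | zero => exact le_refl _
  | succ t => exact le_max_left _ _

theorem iterate_le_one (l : List (ℕ × ℕ)) (t v : ℕ) : iterate η l t v ≤ 1 := by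
  cases t with
  | zero => exact zero_le_one
  | succ t => exact max_le zero_le_one (min_le_left _ _)

theorem abs_reward_le_one (l : List (ℕ × ℕ)) (e : ℕ × ℕ) : |reward η T l e| ≤ 1 := by
  rw [reward, abs_div, Nat.abs_cast]
  refine div_le_one_of_le₀ ?_ (Nat.cast_nonneg _)
  refine (Finset.abs_sum_le_sum_abs _ _).trans ?_
  refine (Finset.sum_le_card_nsmul _ _ 1 fun t _ => ?_).trans (by simp)
  rw [abs_le]
  have h1 := iterate_nonneg (η := η) l t e.1
  have h2 := iterate_le_one (η := η) l t e.1
  have h3 := iterate_nonneg (η := η) l t e.2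
  have h4 := iterate_le_one (η := η) l t e.2
  exact ⟨le_min (by linarith) (by linarith), (min_le_left _ _).trans h2⟩

theorem iterate_perm {l l' : List (ℕ × ℕ)} (h : l.Perm l') (t : ℕ) :
    iterate η l t = iterate η l' t := by
  induction t with
  | zero => rfl
  | succ t ih =>
    funext v
    rw [iterate, iterate, ih, ascend, ascend, (h.map _).sum_eq]

theorem reward_perm {l l' : List (ℕ × ℕ)} (h : l.Perm l') (e : ℕ × ℕ) :
    reward η T l e = reward η T l' e := by
  simp only [reward, iterate_perm h]

theorem iterate_relabel {φ : ℕ → ℕ} (hφ : Function.Injective φ) (l : List (ℕ × ℕ)) (t v : ℕ) :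
    iterate η (l.map (relabel φ)) t (φ v) = iterate η l t v := by
  induction t generalizing v with
  | zero => rfl
  | succ t ih =>
    rw [iterate, iterate, ascend, ascend, ih, List.map_map]
    congr 5
    refine List.map_congr_left fun e _ => ?_
    simp [push, ih, hφ.eq_iff]

theorem reward_relabel {φ : ℕ → ℕ} (hφ : Function.Injective φ) (l : List (ℕ × ℕ)) (e : ℕ × ℕ) :
    reward η T (l.map (relabel φ)) (relabel φ e) = reward η T l e := by
  simp [reward, iterate_relabel hφ]

/-- The vertices that are reached from the edge `a` along at most `j` edges of `l`, regardless of
their direction. -/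
def ball (a : ℕ × ℕ) (l : List (ℕ × ℕ)) : ℕ → Set ℕ
  | 0 => {a.1, a.2}
  | j + 1 => {v | v ∈ ball a l j ∨
      ∃ e ∈ l, (e.1 ∈ ball a l j ∨ e.2 ∈ ball a l j) ∧ (v = e.1 ∨ v = e.2)}

theorem ball_mono {a : ℕ × ℕ} {l : List (ℕ × ℕ)} {i j : ℕ} (h : i ≤ j) :
    ball a l i ⊆ ball a l j := by
  induction h with
  | refl => exact le_refl _
  | step _ ih => exact fun v hv => .inl (ih hv)

theorem ball_subset {a : ℕ × ℕ} {l l' : List (ℕ × ℕ)} (h : l ⊆ l') (j : ℕ) :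
    ball a l j ⊆ ball a l' j := by
  induction j with
  | zero => exact le_refl _
  | succ j ih =>
    rintro v (hv | ⟨e, he, h1, h2⟩)
    · exact .inl (ih hv)
    · exact .inr ⟨e, h he, h1.imp (fun h => ih h) (fun h => ih h), h2⟩

/-- The ascent is local: within `t` rounds an edge has no influence beyond distance `t`. -/
theorem iterate_cons_of_far {a y : ℕ × ℕ} {l : List (ℕ × ℕ)} {R : ℕ} (h1 : y.1 ∉ ball a l R)
    (h2 : y.2 ∉ ball a l R) {t j v : ℕ} (htj : t + j ≤ R) (hv : v ∈ ball a l j) :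
    iterate η (a :: y :: l) t v = iterate η (a :: l) t v := by
  induction t generalizing j v with
  | zero => rfl
  | succ t ih =>
    have hy1 : v ≠ y.1 := fun h => h1 (h ▸ ball_mono (by omega) hv)
    have hy2 : v ≠ y.2 := fun h => h2 (h ▸ ball_mono (by omega) hv)
    have hy : push (iterate η (a :: y :: l) t) y v = 0 := by simp [push, hy1, hy2]
    have hsum : ((a :: y :: l).map fun e => push (iterate η (a :: y :: l) t) e v).sum =
        ((a :: l).map fun e => push (iterate η (a :: y :: l) t) e v).sum := by
      simp [hy]
    rw [iterate, iterate, ascend, ascend, ih (j := j) (by omega) hv, hsum]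
    congr 5
    refine List.map_congr_left fun e he => ?_
    by_cases hve : v = e.1 ∨ v = e.2
    · have hmem : e.1 ∈ ball a l (j + 1) ∧ e.2 ∈ ball a l (j + 1) := by
        rcases List.mem_cons.1 he with rfl | he
        · exact ⟨ball_mono (Nat.zero_le _) (by simp [ball]),
            ball_mono (Nat.zero_le _) (by simp [ball])⟩
        · have : e.1 ∈ ball a l j ∨ e.2 ∈ ball a l j :=
            by
            rcases hve with rfl | rfl
            · exact .inl hv
            · exact .inr hv
          exact ⟨.inr ⟨e, he, this, .inl rfl⟩, .inr ⟨e, he, this, .inr rfl⟩⟩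
      simp only [push, ih (j := j + 1) (by omega) hmem.1, ih (j := j + 1) (by omega) hmem.2]
    · rw [not_or] at hve
      simp [push, hve]

theorem reward_cons_of_far {a y : ℕ × ℕ} {l : List (ℕ × ℕ)} (h1 : y.1 ∉ ball a l T)
    (h2 : y.2 ∉ ball a l T) : reward η T (a :: y :: l) a = reward η T (a :: l) a := by
  unfold reward
  congr 1
  refine Finset.sum_congr rfl fun t ht => ?_
  rw [Finset.mem_range] at ht
  rw [iterate_cons_of_far (j := 0) h1 h2 (by omega) (by simp [ball]),
    iterate_cons_of_far (j := 0) h1 h2 (by omega) (by simp [ball])]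

end Ascent

/-! ### Inclusion-exclusion over sublists -/

section Mobius

variable {α β : Type}

/-- The Möbius transform of a function `F` of lists: the alternating sum of `F` over the sublists
of a list. Sublists are taken by position, so parallel edges count as different. -/
def mobius : (List α → ℚ) → List α → ℚ
  | F, [] => F []
  | F, y :: l => mobius (fun S => F (y :: S)) l - mobius F l

theorem mobius_congr {F F' : List α → ℚ} {l : List α}
    (h : ∀ S, S.Sublist l → F S = F' S) : mobius F l = mobius F' l := by
  induction l generalizing F F' with
  | nil => exact h _ (List.Sublist.refl _)
  | cons y l ih =>
    rw [mobius, mobius, ih fun S hS => h _ (hS.cons_cons y), ih fun S hS => h _ (hS.cons y)]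

/-- The Möbius transform vanishes on lists with an element that `F` does not notice. -/
theorem mobius_cons_eq_zero {F : List α → ℚ} {y : α} {l : List α}
    (h : ∀ S, S.Sublist l → F (y :: S) = F S) : mobius F (y :: l) = 0 := by
  rw [mobius, mobius_congr h, sub_self]

theorem sum_mobius (F : List α → ℚ) (l : List α) :
    (l.sublists'.map (mobius F)).sum = F l := by
  induction l generalizing F with
  | nil => simp [mobius]
  | cons y l ih =>
    rw [List.sublists'_cons, List.map_append, List.sum_append, List.map_map, ih,
      ← ih fun S => F (y :: S), ← ih F, ← List.sum_map_add]
    congr 2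
    funext S
    simp [mobius]

theorem mobius_perm {F : List α → ℚ} (hF : ∀ S S', S.Perm S' → F S = F S') {l l' : List α}
    (h : l.Perm l') : mobius F l = mobius F l' := by
  induction h generalizing F with
  | nil => rfl
  | cons x _ ih =>
    rw [mobius, mobius, ih hF, ih fun S S' h => hF _ _ (h.cons x)]
  | swap x y l =>
    simp only [mobius]
    rw [mobius_congr (F := fun S => F (y :: x :: S)) (F' := fun S => F (x :: y :: S))
      fun S _ => hF _ _ (.swap _ _ _)]
    ring
  | trans _ _ ih₁ ih₂ => rw [ih₁ hF, ih₂ hF]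

theorem abs_mobius_le {F : List α → ℚ} (hF : ∀ S, |F S| ≤ 1) (l : List α) :
    |mobius F l| ≤ 2 ^ l.length := by
  induction l generalizing F with
  | nil => simpa [mobius] using hF []
  | cons y l ih =>
    rw [mobius, List.length_cons, pow_succ]
    have h1 := ih (F := fun S => F (y :: S)) fun S => hF _
    have h2 := ih hF
    have h3 := abs_sub (mobius (fun S => F (y :: S)) l) (mobius F l)
    linarith

theorem mobius_map (f : α → β) (F : List β → ℚ) (l : List α) :
    mobius F (l.map f) = mobius (fun S => F (S.map f)) l := by
  induction l generalizing F with
  | nil => rfl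
  | cons y l ih => rw [List.map_cons, mobius, mobius, ih, ih]; rfl

/-- An element can be dropped from a list without changing a sum over its sublists, if no sublist
that contains it contributes. -/
theorem sum_sublists_drop {W : List α → ℚ} {p q : List α} {y : α}
    (h : ∀ H₁ H₂ : List α, H₁.Sublist p → W (H₁ ++ y :: H₂) = 0) :
    ((p ++ y :: q).sublists'.map W).sum = ((p ++ q).sublists'.map W).sum := by
  induction p generalizing W with
  | nil =>
    have h0 : (q.sublists'.map (W ∘ List.cons y)) = q.sublists'.map fun _ => (0 : ℚ) :=
      List.map_congr_left fun H _ => h [] H (List.Sublist.refl _)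
    simp [h0]
  | cons z p ih =>
    simp only [List.cons_append, List.sublists'_cons, List.map_append, List.sum_append,
      List.map_map]
    rw [ih fun H₁ H₂ h₁ => h H₁ H₂ (h₁.cons z)]
    have := ih (W := W ∘ List.cons z) fun H₁ H₂ h₁ => h (z :: H₁) H₂ (h₁.cons_cons z)
    rw [this]

end Mobius

/-! ### Growing lists of edges -/

/-- Two edges have a common vertex. -/
def Touches (e f : ℕ × ℕ) : Prop := e.1 = f.1 ∨ e.1 = f.2 ∨ e.2 = f.1 ∨ e.2 = f.2

theorem Touches.refl (e : ℕ × ℕ) : Touches e e := .inl rfl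

theorem Touches.symm {e f : ℕ × ℕ} (h : Touches e f) : Touches f e := by
  unfold Touches at *; omega

theorem touches_relabel {φ : ℕ → ℕ} (hφ : Function.Injective φ) (e f : ℕ × ℕ) :
    Touches (relabel φ e) (relabel φ f) ↔ Touches e f := by
  simp [Touches, hφ.eq_iff]

/-- Each edge of the second list touches an edge that comes before it in this list or belongs to
the first list. -/
def Grows : List (ℕ × ℕ) → List (ℕ × ℕ) → Prop
  | _, [] => True
  | P, y :: l => (∃ z ∈ P, Touches z y) ∧ Grows (y :: P) l

theorem Grows.mono {P P' l : List (ℕ × ℕ)} (hP : P ⊆ P') (h : Grows P l) : Grows P' l := by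
  induction l generalizing P P' with
  | nil => trivial
  | cons y l ih =>
    obtain ⟨⟨z, hz, hzy⟩, h2⟩ := h
    exact ⟨⟨z, hP hz, hzy⟩, ih (List.cons_subset_cons y hP) h2⟩

theorem grows_append {P l l' : List (ℕ × ℕ)} :
    Grows P (l ++ l') ↔ Grows P l ∧ Grows (P ++ l) l' := by
  induction l generalizing P with
  | nil => simp [Grows]
  | cons y l ih =>
    rw [List.cons_append, Grows, Grows, ih, and_assoc]
    have h : Grows (y :: P ++ l) l' ↔ Grows (P ++ y :: l) l' :=
      ⟨Grows.mono fun z => by simp; tauto, Grows.mono fun z => by simp; tauto⟩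
    rw [h]

theorem grows_relabel {φ : ℕ → ℕ} (hφ : Function.Injective φ) (P l : List (ℕ × ℕ)) :
    Grows (P.map (relabel φ)) (l.map (relabel φ)) ↔ Grows P l := by
  induction l generalizing P with
  | nil => simp [Grows]
  | cons y l ih =>
    rw [List.map_cons, Grows, Grows, ← List.map_cons, ih]
    refine and_congr_left fun _ => ⟨?_, ?_⟩
    · rintro ⟨z, hz, hzy⟩
      obtain ⟨z, hz', rfl⟩ := List.mem_map.1 hz
      exact ⟨z, hz', (touches_relabel hφ _ _).1 hzy⟩
    · rintro ⟨z, hz, hzy⟩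
      exact ⟨_, List.mem_map_of_mem hz, (touches_relabel hφ _ _).2 hzy⟩

/-- Edges that are all reachable from `a` can be listed in a growing order. -/
theorem exists_perm_grows {a : ℕ × ℕ} {l : List (ℕ × ℕ)} {R : ℕ}
    (h : ∀ y ∈ l, y.1 ∈ ball a l R ∨ y.2 ∈ ball a l R) :
    ∃ l', l'.Perm l ∧ Grows [a] l' := by
  suffices ∀ k, ∀ Q : List (ℕ × ℕ), Q.length = k → ∀ P, (P ++ Q).Perm l → Grows [a] P →
      ∃ l', l'.Perm l ∧ Grows [a] l' from
    this _ l rfl [] (by simp) trivial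
  intro k
  induction k with
  | zero =>
    intro Q hQ P hP hg
    rw [List.length_eq_zero_iff] at hQ
    subst hQ
    exact ⟨P, by simpa using hP, hg⟩
  | succ k ih =>
    intro Q hQ P hP hg
    by_cases hex : ∃ y ∈ Q, ∃ z ∈ a :: P, Touches z y
    · obtain ⟨y, hy, z, hz, hzy⟩ := hex
      refine ih (Q.erase y) (by rw [List.length_erase_of_mem hy]; omega) (P ++ [y]) ?_
        (grows_append.2 ⟨hg, ⟨z, by simpa using hz, hzy⟩, trivial⟩)
      rw [List.append_assoc]
      exact ((List.perm_cons_erase hy).symm.append_left P).trans hP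
    · push Not at hex
      -- no vertex outside `a :: P` is reachable, so `Q` is empty
      have hball : ∀ j, ∀ v ∈ ball a l j, ∃ z ∈ a :: P, v = z.1 ∨ v = z.2 := by
        intro j
        induction j with
        | zero =>
          intro v hv
          exact ⟨a, by simp, hv⟩
        | succ j ihj =>
          rintro v (hv | ⟨e, he, h1, h2⟩)
          · exact ihj v hv
          · rcases List.mem_append.1 (hP.symm.subset he) with heP | heQ
            · exact ⟨e, List.mem_cons_of_mem _ heP, h2⟩
            · exfalso
              rcases h1 with h1 | h1
              · obtain ⟨z, hz, hz'⟩ := ihj _ h1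
                exact hex e heQ z hz (by unfold Touches; omega)
              · obtain ⟨z, hz, hz'⟩ := ihj _ h1
                exact hex e heQ z hz (by unfold Touches; omega)
      obtain ⟨y, hy⟩ := List.exists_mem_of_length_eq_add_one hQ
      exfalso
      rcases h y (hP.subset (List.mem_append_right _ hy)) with h1 | h1
      · obtain ⟨z, hz, hz'⟩ := hball _ _ h1
        exact hex y hy z hz (by unfold Touches; omega)
      · obtain ⟨z, hz, hz'⟩ := hball _ _ h1
        exact hex y hy z hz (by unfold Touches; omega)

/-! ### The weight of an observed sequence of edges -/

section Weight

variable (η : ℚ) (T L : ℕ)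

/-- The Möbius transform of the reward of the edge `a`, as a function of the other edges. -/
def coeff (a : ℕ × ℕ) (l : List (ℕ × ℕ)) : ℚ := mobius (fun S => reward η T (a :: S) a) l

open Classical in
/-- The weight that the estimator gives to seeing, with the root `a`, the edges of `l` in this
order: if the order is growing, the coefficient of this set of edges, divided by the probability
that a uniformly random order is growing. Sequences longer than `L` are ignored. -/
noncomputable def weight (a : ℕ × ℕ) (l : List (ℕ × ℕ)) : ℚ :=
  if Grows [a] l ∧ l.length ≤ L then
    coeff η T a l * l.length.factorial / (l.permutations.countP fun l' => Grows [a] l')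
  else 0

variable {η T L}

theorem coeff_perm (a : ℕ × ℕ) {l l' : List (ℕ × ℕ)} (h : l.Perm l') :
    coeff η T a l = coeff η T a l' :=
  mobius_perm (fun _ _ hS => reward_perm (hS.cons a) a) h

theorem abs_coeff_le (a : ℕ × ℕ) (l : List (ℕ × ℕ)) : |coeff η T a l| ≤ 2 ^ l.length :=
  abs_mobius_le (fun _ => abs_reward_le_one _ _) l

theorem sum_coeff (a : ℕ × ℕ) (l : List (ℕ × ℕ)) :
    (l.sublists'.map (coeff η T a)).sum = reward η T (a :: l) a :=
  sum_mobius _ l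

/-- A set of edges with a nonzero coefficient lies in the ball of radius `T` about the root. -/
theorem mem_ball_of_coeff_ne_zero {a : ℕ × ℕ} {l : List (ℕ × ℕ)} (h : coeff η T a l ≠ 0) :
    ∀ y ∈ l, y.1 ∈ ball a l T ∨ y.2 ∈ ball a l T := by
  intro y hy
  by_contra hfar
  rw [not_or] at hfar
  refine h ?_
  rw [coeff_perm a (List.perm_cons_erase hy)]
  refine mobius_cons_eq_zero fun S hS => reward_cons_of_far ?_ ?_
  · exact fun h' => hfar.1 (ball_subset (List.Subset.trans hS.subset List.erase_subset) _ h')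
  · exact fun h' => hfar.2 (ball_subset (List.Subset.trans hS.subset List.erase_subset) _ h')

theorem grows_of_weight_ne_zero {a : ℕ × ℕ} {l : List (ℕ × ℕ)} (h : weight η T L a l ≠ 0) :
    Grows [a] l ∧ l.length ≤ L := by
  unfold weight at h
  split_ifs at h with h'
  · exact h'
  · exact absurd rfl h

theorem coeff_ne_zero_of_weight_ne_zero {a : ℕ × ℕ} {l : List (ℕ × ℕ)}
    (h : weight η T L a l ≠ 0) : coeff η T a l ≠ 0 := by
  intro h'
  simp [weight, h'] at h

theorem abs_weight_le (a : ℕ × ℕ) (l : List (ℕ × ℕ)) :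
    |weight η T L a l| ≤ 2 ^ L * L.factorial := by
  classical
  unfold weight
  split_ifs with h
  · rw [abs_div, abs_mul, Nat.abs_cast, Nat.abs_cast]
    refine (div_le_self (by positivity) ?_).trans ?_
    · exact_mod_cast List.countP_pos_iff.2
        ⟨l, List.mem_permutations.2 (.refl _), by simpa using h.1⟩
    · gcongr
      · exact (abs_coeff_le a l).trans (pow_le_pow_right₀ (by norm_num) h.2)
      · exact h.2
  · simp

/-- The average of the weight over the orders of a set of edges is the coefficient of this set. -/
theorem sum_weight_permutations {a : ℕ × ℕ} {l : List (ℕ × ℕ)}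
    (h : coeff η T a l ≠ 0 → l.length ≤ L) :
    (l.permutations.map (weight η T L a)).sum = l.length.factorial * coeff η T a l := by
  classical
  by_cases h0 : coeff η T a l = 0
  · rw [h0, mul_zero]
    refine List.sum_eq_zero fun x hx => ?_
    obtain ⟨l', hl', rfl⟩ := List.mem_map.1 hx
    by_contra hne
    exact coeff_ne_zero_of_weight_ne_zero hne
      ((coeff_perm a (List.mem_permutations.1 hl')).trans h0)
  · have hL := h h0
    set k := l.permutations.countP fun l' => Grows [a] l' with hk
    have hkpos : 0 < k := by
      obtain ⟨l', hl', hg⟩ := exists_perm_grows (mem_ball_of_coeff_ne_zero h0)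
      exact List.countP_pos_iff.2 ⟨l', List.mem_permutations.2 hl', by simpa using hg⟩
    have hw : ∀ l' ∈ l.permutations, weight η T L a l' =
        if Grows [a] l' then coeff η T a l * l.length.factorial / k else 0 := by
      intro l' hl'
      have hp := List.mem_permutations.1 hl'
      have hc : (l'.permutations.countP fun l'' => Grows [a] l'') = k :=
        hp.permutations.countP_eq _
      simp only [weight, hp.length_eq, hL, and_true, hc, coeff_perm a hp]
    have hsum : ∀ (m : List (List (ℕ × ℕ))) (x : ℚ),
        (m.map fun l' => if Grows [a] l' then x else 0).sum =
          (m.countP fun l' => Grows [a] l') * x := by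
      intro m x
      induction m with
      | nil => simp
      | cons b m ih =>
        rw [List.map_cons, List.sum_cons, ih, List.countP_cons]
        by_cases hb : Grows [a] b
        · simp [hb]; ring
        · simp [hb]
    rw [List.map_congr_left hw, hsum, ← hk]
    have : (k : ℚ) ≠ 0 := by exact_mod_cast hkpos.ne'
    field_simp

theorem coeff_relabel {φ : ℕ → ℕ} (hφ : Function.Injective φ) (a : ℕ × ℕ) (l : List (ℕ × ℕ)) :
    coeff η T (relabel φ a) (l.map (relabel φ)) = coeff η T a l := by
  unfold coeff
  rw [mobius_map]
  refine mobius_congr fun S _ => ?_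
  rw [← List.map_cons, reward_relabel hφ]

theorem weight_relabel {φ : ℕ → ℕ} (hφ : Function.Injective φ) (a : ℕ × ℕ)
    (l : List (ℕ × ℕ)) :
    weight η T L (relabel φ a) (l.map (relabel φ)) = weight η T L a l := by
  classical
  have hg : ∀ l : List (ℕ × ℕ), Grows [relabel φ a] (l.map (relabel φ)) ↔ Grows [a] l :=
    fun l => grows_relabel hφ [a] l
  have hc : ((l.map (relabel φ)).permutations.countP fun l' => Grows [relabel φ a] l') =
      l.permutations.countP fun l' => Grows [a] l' := by
    rw [← List.map_permutations, List.countP_map]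
    exact List.countP_congr fun l' _ => by simp [hg]
  unfold weight
  rw [hc, coeff_relabel hφ, List.length_map]
  exact if_congr (and_congr_left' (hg l)) rfl rfl

end Weight

/-! ### The estimator and the edges it has to retain -/

section Estimator

variable (η : ℚ) (T L s K : ℕ)

/-- The value of `g` at the `i`-th edge of `l` and the list of the other edges. -/
def probe (g : ℕ × ℕ → List (ℕ × ℕ) → ℚ) (l : List (ℕ × ℕ)) (i : ℕ) : ℚ :=
  l[i]?.elim 0 fun a => g a (l.eraseIdx i)

/-- The total weight of the sublists of `l`, seen from the root `a`. -/
noncomputable def totalWeight (a : ℕ × ℕ) (l : List (ℕ × ℕ)) : ℚ :=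
  (l.sublists'.map (weight η T L a)).sum

/-- The average reward of the edges in the graph that they form. -/
def meanReward (l : List (ℕ × ℕ)) : ℚ :=
  (∑ i ∈ Finset.range l.length, probe (fun a r => reward η T (a :: r) a) l i) / l.length

/-- The estimate of the average reward: the exact value for fewer than `s` edges, and otherwise
the average of the total weights that are seen from the first `s` edges. -/
noncomputable def estimate (l : List (ℕ × ℕ)) : ℚ :=
  if l.length < s then meanReward η T l
  else (∑ i ∈ Finset.range s, probe (totalWeight η T L) l i) / s

/-- The rule for retaining edges: the first `s` of them are roots; a later edge is retained if it
extends a growing sequence of fewer than `L` retained edges that starts from a root. At most `K`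
edges are retained. -/
def Keep (l : List (ℕ × ℕ)) (y : ℕ × ℕ) : Prop :=
  l.length < K ∧ (l.length < s ∨ ∃ a ∈ l.take s, ∃ H : List (ℕ × ℕ), H.Sublist l ∧ H.length < L ∧
    Grows [a] H ∧ ∃ z ∈ a :: H, Touches z y)

variable {η T L s K}

theorem probe_relabel {g : ℕ × ℕ → List (ℕ × ℕ) → ℚ} {φ : ℕ → ℕ}
    (hg : ∀ a l, g (relabel φ a) (l.map (relabel φ)) = g a l) (l : List (ℕ × ℕ)) (i : ℕ) :
    probe g (l.map (relabel φ)) i = probe g l i := by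
  unfold probe
  rw [List.getElem?_map, List.eraseIdx_map]
  cases l[i]? with
  | none => rfl
  | some a => exact hg a _

theorem totalWeight_relabel {φ : ℕ → ℕ} (hφ : Function.Injective φ) (a : ℕ × ℕ)
    (l : List (ℕ × ℕ)) :
    totalWeight η T L (relabel φ a) (l.map (relabel φ)) = totalWeight η T L a l := by
  unfold totalWeight
  rw [List.sublists'_map, List.map_map]
  congr 1
  exact List.map_congr_left fun H _ => weight_relabel hφ a H

theorem estimate_relabel {φ : ℕ → ℕ} (hφ : Function.Injective φ) (l : List (ℕ × ℕ)) :
    estimate η T L s (l.map (relabel φ)) = estimate η T L s l := by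
  have h1 : ∀ a l, reward η T (relabel φ a :: l.map (relabel φ)) (relabel φ a) =
      reward η T (a :: l) a := fun a l => by rw [← List.map_cons, reward_relabel hφ]
  simp only [estimate, meanReward, List.length_map, probe_relabel (totalWeight_relabel hφ),
    probe_relabel (g := fun a r => reward η T (a :: r) a) h1]

theorem keep_relabel {φ : ℕ → ℕ} (hφ : Function.Injective φ) (l : List (ℕ × ℕ)) (y : ℕ × ℕ) :
    Keep L s K (l.map (relabel φ)) (relabel φ y) ↔ Keep L s K l y := by
  unfold Keep
  rw [List.length_map, ← List.map_take]
  refine and_congr_right' (or_congr_right ⟨?_, ?_⟩)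
  · rintro ⟨a, ha, H, hH, hlen, hg, z, hz, hzy⟩
    obtain ⟨a, ha', rfl⟩ := List.mem_map.1 ha
    obtain ⟨H, hH', rfl⟩ := List.sublist_map_iff.1 hH
    rw [← List.map_cons] at hz
    obtain ⟨z, hz', rfl⟩ := List.mem_map.1 hz
    exact ⟨a, ha', H, hH', by simpa using hlen, (grows_relabel hφ [a] H).1 hg, z, hz',
      (touches_relabel hφ _ _).1 hzy⟩
  · rintro ⟨a, ha, H, hH, hlen, hg, z, hz, hzy⟩
    exact ⟨_, List.mem_map_of_mem ha, _, hH.map _, by simpa using hlen,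
      (grows_relabel hφ [a] H).2 hg, _, by rw [← List.map_cons]; exact List.mem_map_of_mem hz,
      (touches_relabel hφ _ _).2 hzy⟩

open Classical in
theorem retain_concat (keep : List (ℕ × ℕ) → ℕ × ℕ → Prop) (p : List (ℕ × ℕ)) (y : ℕ × ℕ) :
    retain keep (p ++ [y]) =
      if keep (retain keep p) y then retain keep p ++ [y] else retain keep p := by
  rw [retain, List.foldl_append]
  rfl

/-- As long as the bound `K` is not reached, the total weights seen from the roots can be computed
from the retained edges. -/
theorem retain_spec (p : List (ℕ × ℕ))
    (hK : ∀ p', p' <+: p → (retain (Keep L s K) p').length < K) :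
    (p.length ≤ s → retain (Keep L s K) p = p) ∧
    (s ≤ p.length → s ≤ (retain (Keep L s K) p).length ∧
      (retain (Keep L s K) p).take s = p.take s ∧
      ∀ i < s, ∀ a, p[i]? = some a → ∀ q,
        totalWeight η T L a ((retain (Keep L s K) p).eraseIdx i ++ q) =
          totalWeight η T L a (p.eraseIdx i ++ q)) := by
  classical
  induction p using List.reverseRecOn with
  | nil => exact ⟨fun _ => rfl, fun _ => ⟨by simpa, rfl, fun i hi a ha => by simp at ha⟩⟩
  | append_singleton p y ih =>
    obtain ⟨ih1, ih2⟩ := ih fun p' hp' => hK p' (hp'.trans (List.prefix_append _ _))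
    have hlt := hK p (List.prefix_append _ _)
    rw [List.length_append, List.length_singleton]
    by_cases hs : p.length < s
    · have hkeep : Keep L s K (retain (Keep L s K) p) y := ⟨hlt, .inl (by rwa [ih1 hs.le])⟩
      have heq : retain (Keep L s K) (p ++ [y]) = p ++ [y] := by
        rw [retain_concat, if_pos hkeep, ih1 hs.le]
      rw [heq]
      exact ⟨fun _ => rfl, fun h => ⟨by simpa using h, rfl, fun _ _ _ _ _ => rfl⟩⟩
    · rw [not_lt] at hs
      obtain ⟨h1, h2, h3⟩ := ih2 hs
      refine ⟨fun h => by omega, fun _ => ?_⟩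
      have htake : (p ++ [y]).take s = p.take s := List.take_append_of_le_length hs
      have hget : ∀ i < s, ∀ a, (p ++ [y])[i]? = some a → p[i]? = some a := fun i hi a ha => by
        rwa [List.getElem?_append_left (by omega)] at ha
      rw [htake]
      by_cases hkeep : Keep L s K (retain (Keep L s K) p) y
      · rw [retain_concat, if_pos hkeep]
        refine ⟨by simp; omega, by rw [List.take_append_of_le_length h1, h2],
          fun i hi a ha q => ?_⟩
        rw [List.eraseIdx_append_of_lt_length (by omega),
          List.eraseIdx_append_of_lt_length (by omega), List.append_assoc, List.append_assoc]
        exact h3 i hi a (hget i hi a ha) _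
      · rw [retain_concat, if_neg hkeep]
        refine ⟨h1, h2, fun i hi a ha q => ?_⟩
        rw [List.eraseIdx_append_of_lt_length (l := p) (by omega), List.append_assoc,
          List.singleton_append, ← h3 i hi a (hget i hi a ha)]
        symm
        refine sum_sublists_drop fun H₁ H₂ hH₁ => ?_
        by_contra hne
        obtain ⟨hg, hlen⟩ := grows_of_weight_ne_zero hne
        obtain ⟨hg1, hg2⟩ := grows_append.1 hg
        refine hkeep ⟨hlt, .inr ⟨a, ?_, H₁, hH₁.trans (List.eraseIdx_sublist _ _), ?_, hg1, hg2.1⟩⟩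
        · rw [h2]
          refine List.mem_of_getElem? (i := i) ?_
          rw [List.getElem?_take_of_lt hi]
          exact hget i hi a ha
        · simp at hlen; omega

theorem estimate_retain (p : List (ℕ × ℕ))
    (hK : ∀ p', p' <+: p → (retain (Keep L s K) p').length < K) :
    estimate η T L s (retain (Keep L s K) p) = estimate η T L s p := by
  obtain ⟨h1, h2⟩ := retain_spec (η := η) (T := T) p hK
  rcases le_total p.length s with h | h
  · rw [h1 h]
  · obtain ⟨h3, h4, h5⟩ := h2 h
    unfold estimate
    rw [if_neg (by omega), if_neg (by omega)]
    congr 1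
    refine Finset.sum_congr rfl fun i hi => ?_
    rw [Finset.mem_range] at hi
    unfold probe
    rw [← List.getElem?_take_of_lt hi, h4, List.getElem?_take_of_lt hi]
    cases ha : p[i]? with
    | none => rfl
    | some a => simpa using h5 i hi a ha []

end Estimator

/-! ### Distances between labelled edges -/

section Near

variable {m : ℕ} (ends : Fin m → ℕ × ℕ)

/-- The edges with labels `a` and `b` are connected by a chain of `j` steps, each of them between
edges that touch. -/
def Near : ℕ → Fin m → Fin m → Prop
  | 0, a, b => a = b
  | j + 1, a, b => ∃ c, Near j a c ∧ Touches (ends c) (ends b)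

variable {ends}

theorem Near.succ {j : ℕ} {a b : Fin m} (h : Near ends j a b) : Near ends (j + 1) a b :=
  ⟨b, h, Touches.refl _⟩

theorem Near.mono {i j : ℕ} (hij : i ≤ j) {a b : Fin m} (h : Near ends i a b) :
    Near ends j a b := by
  induction hij with
  | refl => exact h
  | step _ ih => exact ih.succ

theorem Near.trans {i j : ℕ} {a b c : Fin m} (h : Near ends i a b) (h' : Near ends j b c) :
    Near ends (i + j) a c := by
  induction j generalizing c with
  | zero => exact h' ▸ h
  | succ j ih =>
    obtain ⟨d, hd, hdc⟩ := h'
    exact ⟨d, ih hd, hdc⟩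

theorem Near.symm {j : ℕ} {a b : Fin m} (h : Near ends j a b) : Near ends j b a := by
  induction j generalizing b with
  | zero => exact Eq.symm h
  | succ j ih =>
    obtain ⟨c, hc, hcb⟩ := h
    have h1 : Near ends 1 b c := ⟨b, rfl, hcb.symm⟩
    exact Nat.add_comm 1 j ▸ h1.trans (ih hc)

open Classical in
theorem card_near_le {Δ : ℕ}
    (hΔ : ∀ c, (Finset.univ.filter fun b => Touches (ends c) (ends b)).card ≤ Δ) (j : ℕ)
    (a : Fin m) : (Finset.univ.filter fun b => Near ends j a b).card ≤ Δ ^ j := by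
  induction j with
  | zero =>
    refine (Finset.card_le_card (t := {a}) fun b hb => ?_).trans (by simp)
    exact Finset.mem_singleton.2 (Finset.mem_filter.1 hb).2.symm
  | succ j ih =>
    have hsub : (Finset.univ.filter fun b => Near ends (j + 1) a b) ⊆
        (Finset.univ.filter fun c => Near ends j a c).biUnion
          fun c => Finset.univ.filter fun b => Touches (ends c) (ends b) := by
      intro b hb
      obtain ⟨c, hc, hcb⟩ := (Finset.mem_filter.1 hb).2
      exact Finset.mem_biUnion.2 ⟨c, Finset.mem_filter.2 ⟨Finset.mem_univ _, hc⟩,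
        Finset.mem_filter.2 ⟨Finset.mem_univ _, hcb⟩⟩
    refine (Finset.card_le_card hsub).trans ((Finset.card_biUnion_le_card_mul _ _ Δ
      fun c _ => hΔ c).trans ?_)
    rw [pow_succ]
    exact Nat.mul_le_mul_right _ ih

theorem near_of_mem_ball {a : Fin m} {l : List (Fin m)} {j v : ℕ}
    (hv : v ∈ ball (ends a) (l.map ends) j) :
    ∃ c, Near ends j a c ∧ (v = (ends c).1 ∨ v = (ends c).2) := by
  induction j generalizing v with
  | zero => exact ⟨a, rfl, hv⟩
  | succ j ih =>
    rcases hv with hv | ⟨e, he, h1, h2⟩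
    · obtain ⟨c, hc, hcv⟩ := ih hv
      exact ⟨c, hc.succ, hcv⟩
    · obtain ⟨b, -, rfl⟩ := List.mem_map.1 he
      rcases h1 with h1 | h1 <;> obtain ⟨c, hc, hcv⟩ := ih h1 <;>
        exact ⟨b, ⟨c, hc, by unfold Touches; omega⟩, h2⟩

/-- Only edges close to the root occur in sequences with a nonzero coefficient. -/
theorem near_of_coeff_ne_zero {η : ℚ} {T : ℕ} {a : Fin m} {l : List (Fin m)}
    (h : coeff η T (ends a) (l.map ends) ≠ 0) : ∀ y ∈ l, Near ends (T + 1) a y := by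
  intro y hy
  rcases mem_ball_of_coeff_ne_zero h _ (List.mem_map_of_mem hy) with h1 | h1 <;>
    obtain ⟨c, hc, hcv⟩ := near_of_mem_ball h1 <;>
    exact ⟨c, hc, by unfold Touches; omega⟩

theorem Grows.near {a : Fin m} {P : List (ℕ × ℕ)} {l : List (Fin m)} {j : ℕ}
    (hP : ∀ z ∈ P, ∃ c, ends c = z ∧ Near ends j a c) (h : Grows P (l.map ends)) :
    ∀ b ∈ l, Near ends (j + l.length) a b := by
  induction l generalizing P j with
  | nil => simp
  | cons y l ih =>
    obtain ⟨⟨z, hz, hzy⟩, h2⟩ := h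
    obtain ⟨c, rfl, hc⟩ := hP z hz
    have hy : Near ends (j + 1) a y := ⟨c, hc, hzy⟩
    intro b hb
    rcases List.mem_cons.1 hb with rfl | hb
    · exact hy.mono (by simp)
    · refine (ih (j := j + 1) (P := ends y :: P) (fun w hw => ?_) h2 b hb).mono (by simp; omega)
      rcases List.mem_cons.1 hw with rfl | hw
      · exact ⟨y, rfl, hy⟩
      · obtain ⟨d, hd, hd'⟩ := hP w hw
        exact ⟨d, hd, hd'.succ⟩

/-- All retained edges are close to one of the roots. -/
theorem exists_retain_eq {L s K : ℕ} (hsK : s ≤ K) (l : List (Fin m)) :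
    ∃ r : List (Fin m), r.Sublist l ∧ retain (Keep L s K) (l.map ends) = r.map ends ∧
      r.take s = l.take s ∧ ∀ b ∈ r, ∃ a ∈ l.take s, Near ends L a b := by
  classical
  induction l using List.reverseRecOn with
  | nil => exact ⟨[], by simp, rfl, rfl, by simp⟩
  | append_singleton l y ih =>
    obtain ⟨r, h1, h2, h3, h4⟩ := ih
    have hlen : r.length < s → r = l := by
      intro h
      rw [List.take_of_length_le h.le] at h3
      by_cases hl : l.length ≤ s
      · rwa [List.take_of_length_le hl] at h3
      · rw [h3, List.length_take] at h; omega
    have hmono : ∀ a ∈ l.take s, a ∈ (l ++ [y]).take s := fun a ha =>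
      ((List.prefix_append l [y]).take s).subset ha
    rw [List.map_append, List.map_singleton, retain_concat, h2]
    split_ifs with hk
    · refine ⟨r ++ [y], h1.append (.refl _), by simp, ?_, ?_⟩
      · by_cases hr : r.length < s
        · rw [hlen hr]
        · have hls := h1.length_le
          rw [List.take_append_of_le_length (by omega), List.take_append_of_le_length (by omega),
            h3]
      · intro b hb
        rcases List.mem_append.1 hb with hb | hb
        · obtain ⟨a, ha, hab⟩ := h4 b hb
          exact ⟨a, hmono a ha, hab⟩
        · rw [List.mem_singleton] at hb
          subst hb
          rcases hk.2 with hk | ⟨a', ha', H, hH, hHL, hg, z, hz, hzy⟩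
          · rw [List.length_map] at hk
            have := hlen hk
            subst this
            refine ⟨b, ?_, Near.mono (Nat.zero_le _) rfl⟩
            rw [List.take_of_length_le (by simpa using hk)]
            simp
          · rw [← List.map_take, h3] at ha'
            obtain ⟨a, ha, rfl⟩ := List.mem_map.1 ha'
            obtain ⟨r', -, rfl⟩ := List.sublist_map_iff.1 hH
            refine ⟨a, hmono a ha, ?_⟩
            have hnear := hg.near (a := a) (j := 0) (by simp [Near])
            rw [List.length_map] at hHL
            rcases List.mem_cons.1 hz with rfl | hz
            · exact Near.mono (i := 1) (by omega) ⟨a, rfl, hzy⟩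
            · obtain ⟨c, hc, rfl⟩ := List.mem_map.1 hz
              exact Near.mono (i := 0 + r'.length + 1) (by omega) ⟨c, hnear c hc, hzy⟩
    · refine ⟨r, h1.trans (List.sublist_append_left _ _), rfl, ?_, fun b hb => ?_⟩
      · by_cases hr : r.length < s
        · refine absurd ⟨?_, .inl ?_⟩ hk
          · rw [List.length_map]; omega
          · rwa [List.length_map]
        · have hls := h1.length_le
          rw [List.take_append_of_le_length (by omega), h3]
      · obtain ⟨a, ha, hab⟩ := h4 b hb
        exact ⟨a, hmono a ha, hab⟩

theorem length_retain_lt {L s K Δ : ℕ}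
    (hΔ : ∀ c, (open Classical in Finset.univ.filter fun b => Touches (ends c) (ends b)).card ≤ Δ)
    (hK : s * Δ ^ L + s < K) {l : List (Fin m)} (hl : l.Nodup) {p : List (ℕ × ℕ)}
    (hp : p <+: l.map ends) : (retain (Keep L s K) p).length < K := by
  classical
  rw [List.prefix_iff_eq_take] at hp
  rw [hp, ← List.map_take]
  set l' := l.take p.length
  have hl' : l'.Nodup := hl.sublist (List.take_sublist _ _)
  obtain ⟨r, h1, h2, -, h4⟩ := exists_retain_eq (ends := ends) (L := L) (K := K) (s := s)
    (by omega) l'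
  rw [h2, List.length_map, ← List.toFinset_card_of_nodup (hl'.sublist h1)]
  have hsub : r.toFinset ⊆ (l'.take s).toFinset.biUnion
      fun a => Finset.univ.filter fun b => Near ends L a b := by
    intro b hb
    obtain ⟨a, ha, hab⟩ := h4 b (List.mem_toFinset.1 hb)
    exact Finset.mem_biUnion.2 ⟨a, List.mem_toFinset.2 ha, by simpa using hab⟩
  calc r.toFinset.card ≤ _ := Finset.card_le_card hsub
    _ ≤ (l'.take s).toFinset.card * Δ ^ L :=
      Finset.card_biUnion_le_card_mul _ _ _ fun a _ => card_near_le hΔ L a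
    _ ≤ s * Δ ^ L := Nat.mul_le_mul_right _ ((List.toFinset_card_le _).trans (by simp))
    _ < K := by omega

end Near

/-! ### Uniformly random orders -/

section RandomOrder

open Equiv (Perm)

variable {m : ℕ}

/-- The elements of `S` in the order in which `σ` lists them. -/
def order (σ : Perm (Fin m)) (S : Finset (Fin m)) : List (Fin m) :=
  (List.ofFn σ).filter (· ∈ S)

theorem nodup_order (σ : Perm (Fin m)) (S : Finset (Fin m)) : (order σ S).Nodup :=
  (List.nodup_ofFn.2 σ.injective).filter _

theorem mem_order {σ : Perm (Fin m)} {S : Finset (Fin m)} {x : Fin m} :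
    x ∈ order σ S ↔ x ∈ S := by
  simp only [order, List.mem_filter, List.mem_ofFn, decide_eq_true_eq, and_iff_right_iff_imp]
  exact fun _ => σ.surjective x

theorem order_perm_toList (σ : Perm (Fin m)) (S : Finset (Fin m)) :
    (order σ S).Perm S.toList :=
  (List.perm_ext_iff_of_nodup (nodup_order σ S) S.nodup_toList).2 fun x => by
    rw [mem_order, Finset.mem_toList]

theorem order_mul {τ : Perm (Fin m)} (σ : Perm (Fin m)) {S : Finset (Fin m)}
    (hτ : ∀ x, τ x ∈ S ↔ x ∈ S) : order (τ * σ) S = (order σ S).map τ := by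
  have h : List.ofFn ⇑(τ * σ) = (List.ofFn σ).map τ := by
    rw [List.map_ofFn]; rfl
  rw [order, order, h, List.filter_map]
  congr 1
  exact List.filter_congr fun x _ => by simp [hτ]

theorem sum_perm_eq_sum_permutations (X : List (Fin m) → ℚ) {S : Finset (Fin m)}
    {l : List (Fin m)} (hl : l.Nodup) (hS : ∀ x, x ∈ l ↔ x ∈ S) :
    ∑ τ : Perm {x // x ∈ S}, X (l.map (Perm.ofSubtype τ)) = (l.permutations.map X).sum := by
  classical
  have hinj : Function.Injective
      fun τ : Perm {x // x ∈ S} => l.map (Perm.ofSubtype τ) := by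
    intro τ τ' h
    refine Perm.ofSubtype_injective (Equiv.ext fun x => ?_)
    by_cases hx : x ∈ S
    · exact List.map_inj_left.1 h x ((hS x).2 hx)
    · rw [Perm.ofSubtype_apply_of_not_mem _ hx, Perm.ofSubtype_apply_of_not_mem _ hx]
  have himage : (Finset.univ : Finset (Perm {x // x ∈ S})).image
      (fun τ => l.map (Perm.ofSubtype τ)) = l.permutations.toFinset := by
    refine Finset.eq_of_subset_of_card_le (fun l' hl' => ?_) ?_
    · obtain ⟨τ, -, rfl⟩ := Finset.mem_image.1 hl'
      rw [List.mem_toFinset, List.mem_permutations]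
      refine (List.perm_ext_iff_of_nodup (hl.map (Equiv.injective _)) hl).2 fun x => ?_
      rw [List.mem_map]
      constructor
      · rintro ⟨y, hy, rfl⟩
        rw [hS] at hy ⊢
        exact (Perm.ofSubtype_apply_mem_iff_mem τ y).2 hy
      · intro hx
        refine ⟨(Perm.ofSubtype τ).symm x, ?_, by simp⟩
        rw [hS] at hx ⊢
        rw [← Perm.ofSubtype_apply_mem_iff_mem τ]
        simpa using hx
    · have hcard : l.length = S.card := by
        rw [← List.toFinset_card_of_nodup hl]
        congr 1
        ext x
        simp [hS]
      rw [Finset.card_image_of_injective _ hinj, Finset.card_univ, Fintype.card_perm,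
        Fintype.card_coe, List.toFinset_card_of_nodup (List.nodup_permutations l hl),
        List.length_permutations, hcard]
  rw [← List.sum_toFinset X (List.nodup_permutations l hl), ← himage,
    Finset.sum_image fun _ _ _ _ h => hinj h]

/-- The relative order of `S` is uniformly distributed, and independent of every quantity that
does not change when the elements of `S` are permuted. -/
theorem sum_order_mul (X : List (Fin m) → ℚ) (W : Perm (Fin m) → ℚ) (S : Finset (Fin m))
    (hW : ∀ τ : Perm (Fin m), (∀ x, x ∉ S → τ x = x) → ∀ σ, W (τ * σ) = W σ) :
    S.card.factorial * ∑ σ, X (order σ S) * W σ =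
      (S.toList.permutations.map X).sum * ∑ σ, W σ := by
  have h1 : ∀ τ : Perm {x // x ∈ S}, ∑ σ, X (order σ S) * W σ =
      ∑ σ, X ((order σ S).map (Perm.ofSubtype τ)) * W σ := by
    intro τ
    rw [← Equiv.sum_comp (Equiv.mulLeft (Perm.ofSubtype τ))]
    refine Finset.sum_congr rfl fun σ _ => ?_
    rw [Equiv.coe_mulLeft, order_mul σ (Perm.ofSubtype_apply_mem_iff_mem τ),
      hW _ fun x hx => Perm.ofSubtype_apply_of_not_mem _ hx]
  have h2 : ∑ _τ : Perm {x // x ∈ S}, ∑ σ, X (order σ S) * W σ =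
      S.card.factorial * ∑ σ, X (order σ S) * W σ := by
    rw [Finset.sum_const, Finset.card_univ, Fintype.card_perm, Fintype.card_coe, nsmul_eq_mul]
  rw [← h2, Finset.sum_congr rfl fun τ _ => h1 τ, Finset.sum_comm, Finset.mul_sum]
  refine Finset.sum_congr rfl fun σ _ => ?_
  rw [← Finset.sum_mul, sum_perm_eq_sum_permutations X (nodup_order σ S) fun x => mem_order,
    ((order_perm_toList σ S).permutations.map X).sum_eq]

/-- The number of orders with given elements at two given positions does not depend on these
elements. -/
theorem sum_indicator_eq {i j a b a' b' : Fin m} (hab : a ≠ b) (hab' : a' ≠ b') :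
    ∑ σ : Perm (Fin m), (if σ i = a ∧ σ j = b then (1 : ℚ) else 0) =
      ∑ σ : Perm (Fin m), (if σ i = a' ∧ σ j = b' then (1 : ℚ) else 0) := by
  obtain ⟨ρ, h1, h2⟩ : ∃ ρ : Perm (Fin m), ρ a = a' ∧ ρ b = b' := by
    refine ⟨Equiv.swap (Equiv.swap a a' b) b' * Equiv.swap a a', ?_, ?_⟩
    · have h : Equiv.swap a a' b ≠ a' := by
        intro h
        exact hab ((Equiv.swap a a').injective (h.trans (Equiv.swap_apply_left a a').symm)).symm
      rw [Perm.mul_apply, Equiv.swap_apply_left, Equiv.swap_apply_of_ne_of_ne h.symm hab']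
    · rw [Perm.mul_apply, Equiv.swap_apply_left]
  rw [← Equiv.sum_comp (Equiv.mulLeft ρ) fun σ => if σ i = a' ∧ σ j = b' then (1 : ℚ) else 0]
  refine Finset.sum_congr rfl fun σ _ => ?_
  simp only [Equiv.coe_mulLeft, Perm.mul_apply, ← h1, ← h2, ρ.injective.eq_iff]

/-! ### Mean and variance of the estimator -/

/- The estimator is treated abstractly: `w a l` is the weight of seeing the sequence `l` from the
root `a`, and `h a l` is the average of this weight over the orders of `l`. Both vanish unless `l`
is contained in the neighbourhood `nb a`. -/
variable (w h : Fin m → List (Fin m) → ℚ)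

/-- The total weight of the sequences of edges that are seen from `a`, if the other edges arrive in
the order `σ`. -/
def observed (a : Fin m) (σ : Perm (Fin m)) : ℚ :=
  ∑ S ∈ (Finset.univ.erase a).powerset, w a (order σ S)

/-- The sum of the coefficients of the sets of edges other than `a`. -/
noncomputable def expected (a : Fin m) : ℚ :=
  ∑ S ∈ (Finset.univ.erase a).powerset, h a S.toList

variable {w h} {nb : Fin m → Finset (Fin m)}

/-- What is seen from `a` has the mean `expected h a`, and is uncorrelated with every quantity `W`
that does not change when the neighbourhood of `a`, without `a` itself, is permuted. -/
theorem sum_observed_mul (hw : ∀ a l, w a l ≠ 0 → ∀ y ∈ l, y ∈ nb a)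
    (hh : ∀ a l, h a l ≠ 0 → ∀ y ∈ l, y ∈ nb a)
    (havg : ∀ a l, l.Nodup → (l.permutations.map (w a)).sum = l.length.factorial * h a l)
    (a : Fin m) (W : Perm (Fin m) → ℚ)
    (hW : ∀ τ : Perm (Fin m), (∀ x, x ∉ (nb a).erase a → τ x = x) → ∀ σ, W (τ * σ) = W σ) :
    ∑ σ, observed w a σ * W σ = expected h a * ∑ σ, W σ := by
  simp only [observed, expected, Finset.sum_mul]
  rw [Finset.sum_comm]
  refine Finset.sum_congr rfl fun S hS => ?_
  have haS : a ∉ S := fun ha => by simpa using Finset.mem_powerset.1 hS ha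
  by_cases hSn : S ⊆ nb a
  · have key := sum_order_mul (w a) W S fun τ hτ => hW τ fun x hx => hτ x fun hxS =>
      hx (Finset.mem_erase.2 ⟨fun hxa => haS (hxa ▸ hxS), hSn hxS⟩)
    rw [havg a _ S.nodup_toList, Finset.length_toList, mul_assoc] at key
    exact mul_left_cancel₀ (by exact_mod_cast Nat.factorial_ne_zero _) key
  · obtain ⟨y, hyS, hy⟩ := Finset.not_subset.1 hSn
    have h1 : h a S.toList = 0 := by
      by_contra hne
      exact hy (hh a _ hne y (Finset.mem_toList.2 hyS))
    have h2 : ∀ σ, w a (order σ S) = 0 := by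
      intro σ
      by_contra hne
      exact hy (hw a _ hne y (mem_order.2 hyS))
    simp [h1, h2]

/-- What is seen from `b` depends only on the order of the neighbourhood of `b`. -/
theorem observed_mul (hw : ∀ a l, w a l ≠ 0 → ∀ y ∈ l, y ∈ nb a) (b : Fin m)
    {τ : Perm (Fin m)} (hτ : ∀ x ∈ nb b, τ x = x) (σ : Perm (Fin m)) :
    observed w b (τ * σ) = observed w b σ := by
  refine Finset.sum_congr rfl fun S _ => ?_
  by_cases hSn : S ⊆ nb b
  · rw [order_mul]
    · conv_rhs => rw [← List.map_id (order σ S)]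
      congr 1
      exact List.map_congr_left fun x hx => hτ x (hSn (mem_order.1 hx))
    · intro x
      refine ⟨fun hx => ?_, fun hx => by rwa [hτ x (hSn hx)]⟩
      rwa [← τ.injective (hτ _ (hSn hx))]
  · obtain ⟨y, hyS, hy⟩ := Finset.not_subset.1 hSn
    have h2 : ∀ σ, w b (order σ S) = 0 := by
      intro σ
      by_contra hne
      exact hy (hw b _ hne y (mem_order.2 hyS))
    rw [h2, h2]

/-- What is seen from two roots with disjoint neighbourhoods is independent. -/
theorem sum_observed_far (hw : ∀ a l, w a l ≠ 0 → ∀ y ∈ l, y ∈ nb a)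
    (hh : ∀ a l, h a l ≠ 0 → ∀ y ∈ l, y ∈ nb a)
    (havg : ∀ a l, l.Nodup → (l.permutations.map (w a)).sum = l.length.factorial * h a l)
    (hself : ∀ a, a ∈ nb a) {a b : Fin m} (hab : Disjoint (nb a) (nb b)) (i j : Fin m) (μ : ℚ) :
    ∑ σ : Perm (Fin m), (if σ i = a ∧ σ j = b then (1 : ℚ) else 0) *
        ((observed w a σ - μ) * (observed w b σ - μ)) =
      (∑ σ : Perm (Fin m), if σ i = a ∧ σ j = b then (1 : ℚ) else 0) *
        ((expected h a - μ) * (expected h b - μ)) := by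
  have hind : ∀ τ : Perm (Fin m), τ a = a → τ b = b → ∀ σ : Perm (Fin m),
      (if (τ * σ) i = a ∧ (τ * σ) j = b then (1 : ℚ) else 0) =
        if σ i = a ∧ σ j = b then (1 : ℚ) else 0 := by
    intro τ ha hb σ
    have h1 : τ (σ i) = a ↔ σ i = a :=
      ⟨fun h' => τ.injective (h'.trans ha.symm), fun h' => by rw [h', ha]⟩
    have h2 : τ (σ j) = b ↔ σ j = b :=
      ⟨fun h' => τ.injective (h'.trans hb.symm), fun h' => by rw [h', hb]⟩
    simp only [Perm.mul_apply, h1, h2]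
  have hnab : b ∉ nb a := fun hb => Finset.disjoint_left.1 hab hb (hself b)
  have hnba : a ∉ nb b := fun ha => Finset.disjoint_left.1 hab (hself a) ha
  have key₁ := sum_observed_mul hw hh havg a
    (fun σ => (if σ i = a ∧ σ j = b then (1 : ℚ) else 0) * (observed w b σ - μ)) (by
      intro τ hτ σ
      rw [hind τ (hτ a (by simp)) (hτ b (by simp [hnab])), observed_mul hw b fun x hx =>
        hτ x fun hx' => Finset.disjoint_left.1 hab (Finset.mem_of_mem_erase hx') hx])
  have key₂ := sum_observed_mul hw hh havg b
    (fun σ => (if σ i = a ∧ σ j = b then (1 : ℚ) else 0)) (by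
      intro τ hτ σ
      exact hind τ (hτ a (by simp [hnba])) (hτ b (by simp)) σ)
  have e₁ : ∑ σ : Perm (Fin m), (if σ i = a ∧ σ j = b then (1 : ℚ) else 0) *
      ((observed w a σ - μ) * (observed w b σ - μ)) =
      ∑ σ : Perm (Fin m), observed w a σ *
        ((if σ i = a ∧ σ j = b then (1 : ℚ) else 0) * (observed w b σ - μ)) -
      μ * ∑ σ : Perm (Fin m),
        (if σ i = a ∧ σ j = b then (1 : ℚ) else 0) * (observed w b σ - μ) := by
    rw [Finset.mul_sum, ← Finset.sum_sub_distrib]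
    exact Finset.sum_congr rfl fun σ _ => by ring
  have e₂ : ∑ σ : Perm (Fin m),
      (if σ i = a ∧ σ j = b then (1 : ℚ) else 0) * (observed w b σ - μ) =
      ∑ σ : Perm (Fin m), observed w b σ * (if σ i = a ∧ σ j = b then (1 : ℚ) else 0) -
      μ * ∑ σ : Perm (Fin m), (if σ i = a ∧ σ j = b then (1 : ℚ) else 0) := by
    rw [Finset.mul_sum, ← Finset.sum_sub_distrib]
    exact Finset.sum_congr rfl fun σ _ => by ring
  rw [e₁, key₁, e₂, key₂]
  ring

/-- The covariance of what is seen from the roots at two different positions is small, because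
most pairs of roots are far apart. -/
theorem sum_covariance_le (hw : ∀ a l, w a l ≠ 0 → ∀ y ∈ l, y ∈ nb a)
    (hh : ∀ a l, h a l ≠ 0 → ∀ y ∈ l, y ∈ nb a)
    (havg : ∀ a l, l.Nodup → (l.permutations.map (w a)).sum = l.length.factorial * h a l)
    (hself : ∀ a, a ∈ nb a) {M : ℚ} {B : ℕ} (hobs : ∀ a σ, |observed w a σ| ≤ M)
    (hexp : ∀ a, |expected h a| ≤ M)
    (hB : ∀ a, (Finset.univ.filter fun b => ¬ Disjoint (nb a) (nb b)).card ≤ B)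
    {μ : ℚ} (hμ : m * μ = ∑ a, expected h a) (hm : 2 ≤ m) {i j : Fin m} (hij : i ≠ j) :
    ∑ σ : Perm (Fin m), (observed w (σ i) σ - μ) * (observed w (σ j) σ - μ) ≤
      m.factorial * (8 * M ^ 2 * B / (m - 1)) := by
  have hm0 : (0 : ℚ) < m := by exact_mod_cast (by omega : 0 < m)
  have hm1 : (0 : ℚ) < (m : ℚ) - 1 := by
    have : (2 : ℚ) ≤ m := by exact_mod_cast hm
    linarith
  have hM : 0 ≤ M := (abs_nonneg _).trans (hexp ⟨0, by omega⟩)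
  have hμM : |μ| ≤ M := by
    have h1 : |m * μ| ≤ m * M := by
      rw [hμ]
      refine (Finset.abs_sum_le_sum_abs _ _).trans
        ((Finset.sum_le_card_nsmul _ _ M fun a _ => hexp a).trans (by simp))
    rw [abs_mul, Nat.abs_cast] at h1
    exact le_of_mul_le_mul_left h1 hm0
  have hprod : ∀ x y : ℚ, |x| ≤ M → |y| ≤ M → |(x - μ) * (y - μ)| ≤ 4 * M ^ 2 := by
    intro x y hx hy
    have h1 : |x - μ| ≤ 2 * M := (abs_sub _ _).trans (by linarith)
    have h2 : |y - μ| ≤ 2 * M := (abs_sub _ _).trans (by linarith)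
    rw [abs_mul]
    calc |x - μ| * |y - μ| ≤ (2 * M) * (2 * M) := mul_le_mul h1 h2 (abs_nonneg _) (by linarith)
      _ = 4 * M ^ 2 := by ring
  -- the common number of orders with two prescribed entries
  set a₀ : Fin m := ⟨0, by omega⟩
  set b₀ : Fin m := ⟨1, by omega⟩
  have h₀ : a₀ ≠ b₀ := by simp [a₀, b₀]
  set c : ℚ := ∑ σ : Perm (Fin m), (if σ i = a₀ ∧ σ j = b₀ then (1 : ℚ) else 0) with hc
  have hc0 : 0 ≤ c := Finset.sum_nonneg fun σ _ => by split_ifs <;> norm_num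
  have hcab : ∀ a b : Fin m, a ≠ b →
      ∑ σ : Perm (Fin m), (if σ i = a ∧ σ j = b then (1 : ℚ) else 0) = c := fun a b hab =>
    sum_indicator_eq hab h₀
  have hcm : c * (m * (m - 1)) = m.factorial := by
    have h1 : ∑ p ∈ (Finset.univ : Finset (Fin m)).offDiag, ∑ σ : Perm (Fin m),
        (if σ i = p.1 ∧ σ j = p.2 then (1 : ℚ) else 0) = m.factorial := by
      rw [Finset.sum_comm]
      have h2 : ∀ σ : Perm (Fin m), ∑ p ∈ (Finset.univ : Finset (Fin m)).offDiag,
          (if σ i = p.1 ∧ σ j = p.2 then (1 : ℚ) else 0) = 1 := by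
        intro σ
        rw [Finset.sum_eq_single (σ i, σ j)]
        · simp
        · rintro ⟨a, b⟩ - hne
          rw [if_neg]
          rintro ⟨rfl, rfl⟩
          exact hne rfl
        · intro hmem
          exact absurd (Finset.mem_offDiag.2 ⟨Finset.mem_univ _, Finset.mem_univ _,
            fun h' => hij (σ.injective h')⟩) hmem
      rw [Finset.sum_congr rfl fun σ _ => h2 σ]
      simp [Fintype.card_perm]
    rw [Finset.sum_congr rfl fun p hp => hcab p.1 p.2 (Finset.mem_offDiag.1 hp).2.2,
      Finset.sum_const, Finset.offDiag_card, Finset.card_univ, Fintype.card_fin, nsmul_eq_mul,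
      Nat.cast_sub (Nat.le_mul_self m)] at h1
    rw [← h1]
    push_cast
    ring
  -- split the sum according to the two roots
  have hsplit : ∑ σ : Perm (Fin m), (observed w (σ i) σ - μ) * (observed w (σ j) σ - μ) =
      ∑ a, ∑ b, ∑ σ : Perm (Fin m), (if σ i = a ∧ σ j = b then (1 : ℚ) else 0) *
        ((observed w a σ - μ) * (observed w b σ - μ)) := by
    rw [Finset.sum_congr rfl fun a _ => Finset.sum_comm, Finset.sum_comm]
    refine Finset.sum_congr rfl fun σ _ => ?_
    rw [Finset.sum_eq_single (σ i), Finset.sum_eq_single (σ j)]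
    · simp
    · intro b _ hb
      rw [if_neg fun h' => hb h'.2.symm, zero_mul]
    · simp
    · intro a _ ha
      exact Finset.sum_eq_zero fun b _ => by rw [if_neg fun h' => ha h'.1.symm, zero_mul]
    · simp
  -- for distant roots the inner sum is exactly `c * (expected h a - μ) * (expected h b - μ)`; the
  -- main terms of all pairs add up to `0`, and the close pairs are charged `8 * M ^ 2` each
  have hterm : ∀ a b : Fin m, ∑ σ : Perm (Fin m),
      (if σ i = a ∧ σ j = b then (1 : ℚ) else 0) *
        ((observed w a σ - μ) * (observed w b σ - μ)) ≤
      c * ((expected h a - μ) * (expected h b - μ) - (if a = b then (expected h a - μ) ^ 2 else 0)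
        + if Disjoint (nb a) (nb b) then 0 else 8 * M ^ 2) := by
    intro a b
    by_cases hd : Disjoint (nb a) (nb b)
    · have hab : a ≠ b := by
        rintro rfl
        exact Finset.disjoint_left.1 hd (hself a) (hself a)
      rw [sum_observed_far hw hh havg hself hd, hcab a b hab, if_neg hab, if_pos hd]
      simp
    · rw [if_neg hd]
      by_cases hab : a = b
      · subst hab
        rw [if_pos rfl]
        refine (Finset.sum_nonpos fun σ _ => ?_).trans (mul_nonneg hc0 (by nlinarith))
        rw [if_neg fun h' => hij (σ.injective (h'.1.trans h'.2.symm)), zero_mul]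
      · rw [if_neg hab, sub_zero]
        have h1 := neg_le_of_abs_le (hprod _ _ (hexp a) (hexp b))
        calc _ ≤ ∑ σ : Perm (Fin m), (if σ i = a ∧ σ j = b then (1 : ℚ) else 0) * (4 * M ^ 2) := by
              refine Finset.sum_le_sum fun σ _ => mul_le_mul_of_nonneg_left
                (le_of_abs_le (hprod _ _ (hobs a σ) (hobs b σ))) (by split_ifs <;> norm_num)
          _ = c * (4 * M ^ 2) := by rw [← Finset.sum_mul, hcab a b hab]
          _ ≤ _ := mul_le_mul_of_nonneg_left (by linarith) hc0
  have hzero : ∑ a, (expected h a - μ) = 0 := by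
    rw [Finset.sum_sub_distrib, ← hμ]; simp
  calc _ ≤ ∑ a, ∑ b, c * ((expected h a - μ) * (expected h b - μ)
          - (if a = b then (expected h a - μ) ^ 2 else 0)
          + if Disjoint (nb a) (nb b) then 0 else 8 * M ^ 2) := by
        rw [hsplit]
        exact Finset.sum_le_sum fun a _ => Finset.sum_le_sum fun b _ => hterm a b
    _ = c * ∑ a, (-(expected h a - μ) ^ 2 +
          (Finset.univ.filter fun b => ¬ Disjoint (nb a) (nb b)).card * (8 * M ^ 2)) := by
        rw [Finset.mul_sum]
        refine Finset.sum_congr rfl fun a _ => ?_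
        rw [← Finset.mul_sum, Finset.sum_add_distrib, Finset.sum_sub_distrib, ← Finset.mul_sum,
          hzero, Finset.sum_ite_eq, if_pos (Finset.mem_univ _), mul_zero, zero_sub]
        congr 2
        rw [← nsmul_eq_mul, ← Finset.sum_const, Finset.sum_filter]
        exact Finset.sum_congr rfl fun b _ => by rw [ite_not]
    _ ≤ c * ∑ _a : Fin m, B * (8 * M ^ 2) := by
        refine mul_le_mul_of_nonneg_left (Finset.sum_le_sum fun a _ => ?_) hc0
        have h1 : ((Finset.univ.filter fun b => ¬ Disjoint (nb a) (nb b)).card : ℚ) ≤ B := by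
          exact_mod_cast hB a
        have h2 := mul_le_mul_of_nonneg_right h1 (by positivity : 0 ≤ 8 * M ^ 2)
        have h3 := sq_nonneg (expected h a - μ)
        linarith
    _ = m.factorial * (8 * M ^ 2 * B / (m - 1)) := by
        rw [← hcm, Finset.sum_const, Finset.card_univ, Fintype.card_fin, nsmul_eq_mul]
        field_simp

/-- **Concentration.** The average over `s` roots deviates from the mean by more than `δ` for at
most one percent of the orders, if `s` is large. -/
theorem card_deviation_le (hw : ∀ a l, w a l ≠ 0 → ∀ y ∈ l, y ∈ nb a)
    (hh : ∀ a l, h a l ≠ 0 → ∀ y ∈ l, y ∈ nb a)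
    (havg : ∀ a l, l.Nodup → (l.permutations.map (w a)).sum = l.length.factorial * h a l)
    (hself : ∀ a, a ∈ nb a) {M : ℚ} {B : ℕ} (hobs : ∀ a σ, |observed w a σ| ≤ M)
    (hexp : ∀ a, |expected h a| ≤ M)
    (hB : ∀ a, (Finset.univ.filter fun b => ¬ Disjoint (nb a) (nb b)).card ≤ B)
    {μ : ℚ} (hμ : m * μ = ∑ a, expected h a) {δ : ℚ} (hδ : 0 < δ) {I : Finset (Fin m)}
    (hI : 2 ≤ I.card) (hIδ : 100 * (M ^ 2 * (4 + 16 * B)) ≤ I.card * δ ^ 2) :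
    100 * (((Finset.univ : Finset (Perm (Fin m))).filter fun σ =>
      δ < |(∑ i ∈ I, observed w (σ i) σ) / I.card - μ|).card : ℚ) ≤ m.factorial := by
  set s := I.card with hs
  have hsm : s ≤ m := by simpa using Finset.card_le_univ I
  have hs0 : (0 : ℚ) < s := by exact_mod_cast (by omega : 0 < s)
  have hs2 : (2 : ℚ) ≤ s := by exact_mod_cast hI
  have hsm' : (s : ℚ) ≤ m := by exact_mod_cast hsm
  have hm1 : (0 : ℚ) < (m : ℚ) - 1 := by linarith
  have hμM : |μ| ≤ M := by
    have h1 : |m * μ| ≤ m * M := by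
      rw [hμ]
      refine (Finset.abs_sum_le_sum_abs _ _).trans
        ((Finset.sum_le_card_nsmul _ _ M fun a _ => hexp a).trans (by simp))
    rw [abs_mul, Nat.abs_cast] at h1
    exact le_of_mul_le_mul_left h1 (by linarith)
  have hdiag : ∀ i, ∑ σ : Perm (Fin m), (observed w (σ i) σ - μ) * (observed w (σ i) σ - μ) ≤
      m.factorial * (4 * M ^ 2) := by
    intro i
    refine (Finset.sum_le_card_nsmul _ _ (4 * M ^ 2) fun σ _ => ?_).trans
      (by simp [Fintype.card_perm])
    have h1 : |observed w (σ i) σ - μ| ≤ 2 * M :=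
      (abs_sub _ _).trans (by linarith [hobs (σ i) σ])
    rw [abs_le] at h1
    nlinarith [h1.1, h1.2]
  have hM2 : 0 ≤ M ^ 2 := sq_nonneg M
  have hsecond : ∑ σ : Perm (Fin m), (∑ i ∈ I, (observed w (σ i) σ - μ)) ^ 2 ≤
      m.factorial * (s * (M ^ 2 * (4 + 16 * B))) := by
    have hbound : ∀ i ∈ I, ∀ j ∈ I, ∑ σ : Perm (Fin m),
        (observed w (σ i) σ - μ) * (observed w (σ j) σ - μ) ≤
        (if i = j then m.factorial * (4 * M ^ 2) else 0) +
          m.factorial * (8 * M ^ 2 * B / (m - 1)) := by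
      intro i _ j _
      have hnn : (0 : ℚ) ≤ m.factorial * (8 * M ^ 2 * B / (m - 1)) := by positivity
      split_ifs with hij
      · subst hij
        linarith [hdiag i]
      · rw [zero_add]
        exact sum_covariance_le hw hh havg hself hobs hexp hB hμ (by omega) hij
    calc _ = ∑ i ∈ I, ∑ j ∈ I, ∑ σ : Perm (Fin m),
          (observed w (σ i) σ - μ) * (observed w (σ j) σ - μ) := by
          simp only [sq, Finset.sum_mul_sum]
          rw [Finset.sum_comm]
          exact Finset.sum_congr rfl fun i _ => Finset.sum_comm
      _ ≤ ∑ i ∈ I, ∑ j ∈ I, ((if i = j then m.factorial * (4 * M ^ 2) else 0) +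
          m.factorial * (8 * M ^ 2 * B / (m - 1))) :=
          Finset.sum_le_sum fun i hi => Finset.sum_le_sum fun j hj => hbound i hi j hj
      _ = m.factorial * (s * (4 * M ^ 2) + (s * s / (m - 1)) * (8 * M ^ 2 * B)) := by
          simp only [Finset.sum_add_distrib, Finset.sum_ite_eq, Finset.sum_ite_mem,
            Finset.inter_self, Finset.sum_const, nsmul_eq_mul, ← hs]
          ring
      _ ≤ m.factorial * (s * (4 * M ^ 2) + (2 * s) * (8 * M ^ 2 * B)) := by
          gcongr
          rw [div_le_iff₀ hm1]
          nlinarith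
      _ = _ := by ring
  -- Chebyshev's inequality
  have hcheb : (((Finset.univ : Finset (Perm (Fin m))).filter fun σ =>
      δ < |(∑ i ∈ I, observed w (σ i) σ) / s - μ|).card : ℚ) * (s * δ) ^ 2 ≤
      ∑ σ : Perm (Fin m), (∑ i ∈ I, (observed w (σ i) σ - μ)) ^ 2 := by
    rw [← nsmul_eq_mul]
    refine (Finset.card_nsmul_le_sum _
      (fun σ => (∑ i ∈ I, (observed w (σ i) σ - μ)) ^ 2) _ fun σ hσ => ?_).trans
      (Finset.sum_le_sum_of_subset_of_nonneg (Finset.filter_subset _ _)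
        fun σ _ _ => sq_nonneg _)
    have h1 := (Finset.mem_filter.1 hσ).2
    have h2 : ∑ i ∈ I, (observed w (σ i) σ - μ) =
        s * ((∑ i ∈ I, observed w (σ i) σ) / s - μ) := by
      rw [Finset.sum_sub_distrib, Finset.sum_const, nsmul_eq_mul, ← hs]
      field_simp
    rw [h2, mul_pow, mul_pow, ← sq_abs ((∑ i ∈ I, observed w (σ i) σ) / s - μ)]
    gcongr
  have hfin := hcheb.trans hsecond
  have hpos : (0 : ℚ) < (s * δ) ^ 2 := by positivity
  refine le_of_mul_le_mul_right ?_ hpos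
  calc _ = 100 * (_ * (s * δ) ^ 2) := by ring
    _ ≤ 100 * (m.factorial * (s * (M ^ 2 * (4 + 16 * B)))) :=
      mul_le_mul_of_nonneg_left hfin (by norm_num)
    _ = m.factorial * s * (100 * (M ^ 2 * (4 + 16 * B))) := by ring
    _ ≤ m.factorial * s * (s * δ ^ 2) := by gcongr
    _ = m.factorial * (s * δ) ^ 2 := by ring

end RandomOrder

/-! ### The linear relaxation of the maximum directed cut -/

section Relaxation

variable {m : ℕ} (ends : Fin m → ℕ × ℕ)

/-- The number of edges that the labelling `x` cuts. -/
def cutCount (x : ℕ → Bool) : ℕ :=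
  (Finset.univ.filter fun a => x (ends a).1 = true ∧ x (ends a).2 = false).card

/-- The objective of the linear relaxation. -/
def relaxation (x : ℕ → ℚ) : ℚ := ∑ a, min (x (ends a).1) (1 - x (ends a).2)

/-- The expected number of edges that are cut if each vertex `v` is independently labelled `true`
with probability `p v`. -/
def multilinear (p : ℕ → ℚ) : ℚ := ∑ a, p (ends a).1 * (1 - p (ends a).2)

/-- The vertices that belong to an edge. -/
def support : Finset ℕ :=
  Finset.univ.image (fun a => (ends a).1) ∪ Finset.univ.image fun a => (ends a).2

variable {ends}

theorem fst_mem_support (a : Fin m) : (ends a).1 ∈ support ends :=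
  Finset.mem_union_left _ (Finset.mem_image_of_mem _ (Finset.mem_univ a))

theorem snd_mem_support (a : Fin m) : (ends a).2 ∈ support ends :=
  Finset.mem_union_right _ (Finset.mem_image_of_mem (fun a => (ends a).2) (Finset.mem_univ a))

theorem card_support_le : (support ends).card ≤ 2 * m := by
  refine (Finset.card_union_le _ _).trans ?_
  have h1 := Finset.card_image_le (s := Finset.univ) (f := fun a => (ends a).1)
  have h2 := Finset.card_image_le (s := Finset.univ) (f := fun a => (ends a).2)
  rw [Finset.card_univ, Fintype.card_fin] at h1 h2
  omega

/-- Fractional labels can be rounded one after the other without decreasing the expected cut. -/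
theorem multilinear_le_of_support (hloop : ∀ a, (ends a).1 ≠ (ends a).2) {k : ℚ}
    (hk : ∀ x, (cutCount ends x : ℚ) ≤ k) (U : Finset ℕ) (p : ℕ → ℚ)
    (h0 : ∀ v, 0 ≤ p v) (h1 : ∀ v, p v ≤ 1) (hU : ∀ v, v ∉ U → p v = 0 ∨ p v = 1) :
    multilinear ends p ≤ k := by
  classical
  induction U using Finset.induction_on generalizing p with
  | empty =>
    refine le_trans (le_of_eq ?_) (hk fun v => decide (p v = 1))
    rw [multilinear, cutCount, Finset.card_filter, Nat.cast_sum]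
    refine Finset.sum_congr rfl fun a _ => ?_
    rcases hU (ends a).1 (by simp) with h | h <;> rcases hU (ends a).2 (by simp) with h' | h' <;>
      simp [h, h']
  | insert u U _ ih =>
    have hupd : ∀ c : ℚ, c = 0 ∨ c = 1 → multilinear ends (Function.update p u c) ≤ k := by
      intro c hc
      have hval : ∀ v, Function.update p u c v = if v = u then c else p v := fun v => by
        rw [Function.update_apply]
      refine ih _ (fun v => ?_) (fun v => ?_) (fun v hv => ?_) <;> rw [hval] <;> split_ifs with hvu
      · rcases hc with rfl | rfl <;> norm_num
      · exact h0 v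
      · rcases hc with rfl | rfl <;> norm_num
      · exact h1 v
      · exact hc
      · exact hU v (by simp [hvu, hv])
    -- without loops the expected cut is affine in `p u`
    have haff : multilinear ends p = (1 - p u) * multilinear ends (Function.update p u 0) +
        p u * multilinear ends (Function.update p u 1) := by
      simp only [multilinear, Finset.mul_sum]
      rw [← Finset.sum_add_distrib]
      refine Finset.sum_congr rfl fun a _ => ?_
      have hne := hloop a
      simp only [Function.update_apply]
      split_ifs with e₁ e₂ e₂
      · exact absurd (e₁.trans e₂.symm) hne
      · rw [e₁]; ring
      · rw [e₂]; ring
      · ring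
    rw [haff]
    nlinarith [hupd 0 (.inl rfl), hupd 1 (.inr rfl), h0 u, h1 u]

theorem multilinear_le (hloop : ∀ a, (ends a).1 ≠ (ends a).2) {k : ℚ}
    (hk : ∀ x, (cutCount ends x : ℚ) ≤ k) {p : ℕ → ℚ} (h0 : ∀ v, 0 ≤ p v) (h1 : ∀ v, p v ≤ 1) :
    multilinear ends p ≤ k := by
  have heq : multilinear ends p =
      multilinear ends fun v => if v ∈ support ends then p v else 0 := by
    refine Finset.sum_congr rfl fun a _ => ?_
    simp only [fst_mem_support, snd_mem_support, if_true]
  rw [heq]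
  refine multilinear_le_of_support hloop hk (support ends) _ (fun v => ?_) (fun v => ?_)
    fun v hv => .inl (if_neg hv)
  · split_ifs
    exacts [h0 v, le_refl _]
  · split_ifs
    exacts [h1 v, zero_le_one]

/-- A quarter of the edges can be cut. -/
theorem card_div_four_le (hloop : ∀ a, (ends a).1 ≠ (ends a).2) {k : ℚ}
    (hk : ∀ x, (cutCount ends x : ℚ) ≤ k) : (m : ℚ) / 4 ≤ k := by
  refine le_trans (le_of_eq ?_) (multilinear_le hloop hk (p := fun _ => 1 / 2)
    (fun _ => by norm_num) fun _ => by norm_num)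
  simp only [multilinear, Finset.sum_const, Finset.card_univ, Fintype.card_fin, nsmul_eq_mul]
  ring

/-- The linear relaxation is at most twice the maximum cut: label `v` with probability
`1 / 4 + x v / 2`. -/
theorem relaxation_le (hloop : ∀ a, (ends a).1 ≠ (ends a).2) {k : ℚ}
    (hk : ∀ x, (cutCount ends x : ℚ) ≤ k) {x : ℕ → ℚ} (h0 : ∀ v, 0 ≤ x v) (h1 : ∀ v, x v ≤ 1) :
    relaxation ends x ≤ 2 * k := by
  have h := multilinear_le hloop hk (p := fun v => 1 / 4 + x v / 2)
    (fun v => by linarith [h0 v]) fun v => by linarith [h1 v]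
  have h2 : relaxation ends x ≤ 2 * multilinear ends fun v => 1 / 4 + x v / 2 := by
    rw [relaxation, multilinear, Finset.mul_sum]
    refine Finset.sum_le_sum fun a _ => ?_
    set c := min (x (ends a).1) (1 - x (ends a).2) with hc
    have hc1 : c ≤ x (ends a).1 := min_le_left _ _
    have hc2 : c ≤ 1 - x (ends a).2 := min_le_right _ _
    have hc0 : 0 ≤ c := le_min (h0 _) (by linarith [h1 (ends a).2])
    have h3 : (1 / 4 + c / 2) * (1 / 4 + c / 2) ≤
        (1 / 4 + x (ends a).1 / 2) * (1 - (1 / 4 + x (ends a).2 / 2)) :=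
      mul_le_mul (by linarith) (by linarith) (by linarith) (by linarith)
    nlinarith [sq_nonneg (1 / 4 - c / 2)]
  linarith

/-! ### Convergence of the ascent -/

variable {η : ℚ}

theorem sum_push_mul (x d : ℕ → ℚ) (a : Fin m) :
    ∑ v ∈ support ends, push x (ends a) v * d v =
      if x (ends a).1 + x (ends a).2 ≤ 1 then d (ends a).1 else - d (ends a).2 := by
  unfold push
  split_ifs with h
  · simp [fst_mem_support]
  · simp [snd_mem_support]

/-- The total push on a vertex. -/
def totalPush (ends : Fin m → ℕ × ℕ) (x : ℕ → ℚ) (v : ℕ) : ℚ := ∑ a, push x (ends a) v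

/-- The total push is a supergradient of the relaxation. -/
theorem relaxation_sub_le (x z : ℕ → ℚ) :
    relaxation ends z - relaxation ends x ≤
      ∑ v ∈ support ends, totalPush ends x v * (z v - x v) := by
  simp only [totalPush, Finset.sum_mul]
  rw [Finset.sum_comm, relaxation, relaxation, ← Finset.sum_sub_distrib]
  refine Finset.sum_le_sum fun a _ => ?_
  rw [sum_push_mul x (fun v => z v - x v)]
  have h1 := min_le_left (z (ends a).1) (1 - z (ends a).2)
  have h2 := min_le_right (z (ends a).1) (1 - z (ends a).2)
  split_ifs with h
  · rw [min_eq_left (a := x (ends a).1) (by linarith)]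
    linarith
  · rw [min_eq_right (a := x (ends a).1) (by linarith)]
    linarith

theorem abs_totalPush_le {D : ℕ}
    (hdeg : ∀ v, (Finset.univ.filter fun a => (ends a).1 = v).card +
      (Finset.univ.filter fun a => (ends a).2 = v).card ≤ D) (x : ℕ → ℚ) (v : ℕ) :
    |totalPush ends x v| ≤ D := by
  have h1 : ∀ a, |push x (ends a) v| ≤
      (if (ends a).1 = v then 1 else 0) + if (ends a).2 = v then 1 else 0 := by
    intro a
    simp only [push, eq_comm (a := v)]
    split_ifs <;> norm_num
  refine (Finset.abs_sum_le_sum_abs _ _).trans ((Finset.sum_le_sum fun a _ => h1 a).trans ?_)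
  rw [Finset.sum_add_distrib, Finset.sum_boole, Finset.sum_boole]
  exact_mod_cast hdeg v

theorem sum_sq_totalPush_le {D : ℕ}
    (hdeg : ∀ v, (Finset.univ.filter fun a => (ends a).1 = v).card +
      (Finset.univ.filter fun a => (ends a).2 = v).card ≤ D) (x : ℕ → ℚ) :
    ∑ v ∈ support ends, totalPush ends x v ^ 2 ≤ D * m := by
  have h1 : ∀ v, totalPush ends x v ^ 2 ≤ D * ∑ a, |push x (ends a) v| := by
    intro v
    rw [← sq_abs, sq]
    exact mul_le_mul (abs_totalPush_le hdeg x v) (Finset.abs_sum_le_sum_abs _ _)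
      (abs_nonneg _) (Nat.cast_nonneg _)
  refine (Finset.sum_le_sum fun v _ => h1 v).trans ?_
  rw [← Finset.mul_sum, Finset.sum_comm]
  refine mul_le_mul_of_nonneg_left ?_ (Nat.cast_nonneg _)
  refine (Finset.sum_le_card_nsmul _ _ 1 fun a _ => ?_).trans (by simp)
  unfold push
  split_ifs
  · simp [apply_ite abs, fst_mem_support]
  · simp [apply_ite abs, snd_mem_support]

/-- Projecting to `[0, 1]` does not increase the distance to a point of this interval. -/
theorem sq_clamp_sub_le {y z : ℚ} (h0 : 0 ≤ z) (h1 : z ≤ 1) :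
    (max 0 (min 1 y) - z) ^ 2 ≤ (y - z) ^ 2 := by
  rcases le_total y 0 with hy | hy
  · rw [min_eq_right (by linarith), max_eq_left hy]; nlinarith
  · rcases le_total y 1 with hy' | hy'
    · rw [min_eq_right hy', max_eq_right hy]
    · rw [min_eq_left hy', max_eq_right zero_le_one]; nlinarith

/-- The regret bound for projected supergradient ascent: the squared distance to the comparison
point `z` is a potential. -/
theorem regret_le (hη : 0 ≤ η) {D : ℕ}
    (hdeg : ∀ v, (Finset.univ.filter fun a => (ends a).1 = v).card +
      (Finset.univ.filter fun a => (ends a).2 = v).card ≤ D) {z : ℕ → ℚ} (h0 : ∀ v, 0 ≤ z v)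
    (h1 : ∀ v, z v ≤ 1) (T : ℕ) :
    ∑ v ∈ support ends, (iterate η (List.ofFn ends) T v - z v) ^ 2 +
      2 * η * ∑ t ∈ Finset.range T,
        (relaxation ends z - relaxation ends (iterate η (List.ofFn ends) t)) ≤
      2 * m + T * (η ^ 2 * (D * m)) := by
  induction T with
  | zero =>
    have h2 : ∀ v ∈ support ends, (iterate η (List.ofFn ends) 0 v - z v) ^ 2 ≤ 1 := by
      intro v _
      rw [iterate]
      nlinarith [h0 v, h1 v]
    have h3 : ((support ends).card : ℚ) ≤ 2 * m := by exact_mod_cast card_support_le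
    have h4 := Finset.sum_le_card_nsmul _ _ 1 h2
    rw [nsmul_eq_mul, mul_one] at h4
    simp only [Finset.range_zero, Finset.sum_empty, mul_zero, add_zero, Nat.cast_zero, zero_mul]
    linarith
  | succ T ih =>
    set x := iterate η (List.ofFn ends) T with hx
    have hstep : ∑ v ∈ support ends, (iterate η (List.ofFn ends) (T + 1) v - z v) ^ 2 ≤
        ∑ v ∈ support ends, (x v + η * totalPush ends x v - z v) ^ 2 := by
      refine Finset.sum_le_sum fun v _ => ?_
      rw [iterate, ascend, List.map_ofFn, List.sum_ofFn]
      exact sq_clamp_sub_le (h0 v) (h1 v)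
    have hexpand : ∑ v ∈ support ends, (x v + η * totalPush ends x v - z v) ^ 2 =
        ∑ v ∈ support ends, (x v - z v) ^ 2 -
          2 * η * ∑ v ∈ support ends, totalPush ends x v * (z v - x v) +
          η ^ 2 * ∑ v ∈ support ends, totalPush ends x v ^ 2 := by
      simp only [Finset.mul_sum]
      rw [← Finset.sum_sub_distrib, ← Finset.sum_add_distrib]
      exact Finset.sum_congr rfl fun v _ => by ring
    have h2 := mul_le_mul_of_nonneg_left (relaxation_sub_le (ends := ends) x z)
      (by linarith : 0 ≤ 2 * η)
    have h3 := mul_le_mul_of_nonneg_left (sum_sq_totalPush_le hdeg x) (sq_nonneg η)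
    rw [Finset.sum_range_succ, mul_add]
    push_cast
    linarith

/-- The sum of the rewards is at most twice the maximum cut. -/
theorem sum_reward_le {T : ℕ} (hT : 0 < T) (hloop : ∀ a, (ends a).1 ≠ (ends a).2) {k : ℚ}
    (hk : ∀ x, (cutCount ends x : ℚ) ≤ k) :
    ∑ a, reward η T (List.ofFn ends) (ends a) ≤ 2 * k := by
  simp only [reward]
  rw [← Finset.sum_div, Finset.sum_comm, div_le_iff₀ (by exact_mod_cast hT)]
  refine (Finset.sum_le_card_nsmul _ _ (2 * k) fun t _ => ?_).trans (by simp [mul_comm])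
  exact relaxation_le hloop hk (iterate_nonneg _ t) (iterate_le_one _ t)

/-- The sum of the rewards is almost as large as any cut. -/
theorem cutCount_le_sum_reward {T : ℕ} (hT : 0 < T) (hη : 0 < η) {D : ℕ}
    (hdeg : ∀ v, (Finset.univ.filter fun a => (ends a).1 = v).card +
      (Finset.univ.filter fun a => (ends a).2 = v).card ≤ D) (x : ℕ → Bool) :
    (cutCount ends x : ℚ) ≤ ∑ a, reward η T (List.ofFn ends) (ends a) +
      m * (1 / (η * T) + η * D / 2) := by
  have hT' : (0 : ℚ) < T := by exact_mod_cast hT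
  set z : ℕ → ℚ := fun v => if x v then 1 else 0 with hz
  have hzcut : (cutCount ends x : ℚ) = relaxation ends z := by
    rw [cutCount, relaxation, Finset.card_filter, Nat.cast_sum]
    refine Finset.sum_congr rfl fun a _ => ?_
    cases h : x (ends a).1 <;> cases h' : x (ends a).2 <;> simp [hz, h, h']
  have hreg := regret_le hη.le hdeg (z := z) (fun v => by simp only [hz]; split_ifs <;> norm_num)
    (fun v => by simp only [hz]; split_ifs <;> norm_num) T
  have hpos : 0 ≤ ∑ v ∈ support ends, (iterate η (List.ofFn ends) T v - z v) ^ 2 :=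
    Finset.sum_nonneg fun v _ => sq_nonneg _
  rw [Finset.sum_sub_distrib, Finset.sum_const, Finset.card_range, nsmul_eq_mul] at hreg
  have hrew : T * ∑ a, reward η T (List.ofFn ends) (ends a) =
      ∑ t ∈ Finset.range T, relaxation ends (iterate η (List.ofFn ends) t) := by
    simp only [reward, relaxation]
    rw [← Finset.sum_div, Finset.sum_comm]
    field_simp
  rw [hzcut]
  rw [← hrew] at hreg
  refine le_of_mul_le_mul_left (a := 2 * η * T) ?_ (by positivity)
  have : 2 * η * T * (m * (1 / (η * T) + η * D / 2)) = 2 * m + T * (η ^ 2 * (D * m)) := by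
    field_simp
  rw [mul_add, this]
  linarith

end Relaxation

/-! ### The accuracy of the estimate -/

section Accuracy

open Equiv (Perm)

/-- The sublists of a list without repetitions correspond to the subsets of its elements. -/
theorem sum_map_sublists' {α : Type} [DecidableEq α] (X : List α → ℚ) {l : List α}
    (hl : l.Nodup) :
    (l.sublists'.map X).sum = ∑ S ∈ l.toFinset.powerset, X (l.filter (· ∈ S)) := by
  induction l generalizing X with
  | nil => simp
  | cons y l ih =>
    obtain ⟨hy, hl⟩ := List.nodup_cons.1 hl
    rw [List.sublists'_cons, List.map_append, List.sum_append, List.map_map, ih X hl,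
      ih (X ∘ List.cons y) hl, List.toFinset_cons,
      Finset.sum_powerset_insert (by simpa using hy)]
    congr 1 <;> refine Finset.sum_congr rfl fun S hS => ?_
    · have hyS : y ∉ S := fun h => hy (List.mem_toFinset.1 (Finset.mem_powerset.1 hS h))
      rw [List.filter_cons_of_neg (by simpa using hyS)]
    · rw [List.filter_cons_of_pos (by simp), Function.comp_apply]
      congr 2
      refine List.filter_congr fun x hx => ?_
      have hxy : x ≠ y := fun h => hy (h ▸ hx)
      simp [hxy]

variable {m : ℕ} {ends : Fin m → ℕ × ℕ} {η : ℚ} {T L : ℕ}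

theorem perm_cons_eraseIdx (σ : Perm (Fin m)) (i : Fin m) :
    (σ i :: (List.ofFn σ).eraseIdx i).Perm (List.ofFn σ) := by
  have h : (i : ℕ) < (List.ofFn σ).length := by simp
  have := List.getElem_cons_eraseIdx_perm h
  rwa [List.getElem_ofFn] at this

theorem toFinset_eraseIdx (σ : Perm (Fin m)) (i : Fin m) :
    ((List.ofFn σ).eraseIdx i).toFinset = Finset.univ.erase (σ i) := by
  have hp := perm_cons_eraseIdx σ i
  have hn := List.nodup_cons.1 (hp.nodup_iff.2 (List.nodup_ofFn.2 σ.injective))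
  ext x
  have hx : x ∈ σ i :: (List.ofFn σ).eraseIdx i := hp.mem_iff.2 (List.mem_ofFn.2 (σ.surjective x))
  rw [List.mem_toFinset, Finset.mem_erase, and_iff_left (Finset.mem_univ _)]
  constructor
  · rintro h rfl
    exact hn.1 h
  · intro h
    exact (List.mem_cons.1 hx).resolve_left h

theorem filter_eraseIdx (σ : Perm (Fin m)) (i : Fin m) {S : Finset (Fin m)} (hS : σ i ∉ S) :
    ((List.ofFn σ).eraseIdx i).filter (· ∈ S) = order σ S := by
  have h : (i : ℕ) < (List.ofFn σ).length := by simp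
  rw [order, List.eraseIdx_eq_take_drop_succ]
  conv_rhs => rw [← List.take_append_drop i (List.ofFn σ), List.drop_eq_getElem_cons h]
  rw [List.filter_append, List.filter_append, List.filter_cons_of_neg (by simpa using hS)]

theorem probe_ofFn (g : ℕ × ℕ → List (ℕ × ℕ) → ℚ) (σ : Perm (Fin m)) (i : Fin m) :
    probe g ((List.ofFn σ).map ends) i =
      g (ends (σ i)) (((List.ofFn σ).eraseIdx i).map ends) := by
  have h : (List.ofFn σ)[(i : ℕ)]? = some (σ i) := by simp
  rw [probe, List.getElem?_map, h, List.eraseIdx_map]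
  rfl

/-- The sum that the estimator forms at its `i`-th root. -/
theorem probe_totalWeight (σ : Perm (Fin m)) (i : Fin m) :
    probe (totalWeight η T L) ((List.ofFn σ).map ends) i =
      observed (fun a (l : List (Fin m)) => weight η T L (ends a) (l.map ends)) (σ i) σ := by
  have hn : ((List.ofFn σ).eraseIdx i).Nodup :=
    (List.nodup_ofFn.2 σ.injective).sublist (List.eraseIdx_sublist _ _)
  rw [probe_ofFn, totalWeight, List.sublists'_map, List.map_map,
    sum_map_sublists' _ hn, toFinset_eraseIdx, observed]
  refine Finset.sum_congr rfl fun S hS => ?_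
  rw [filter_eraseIdx σ i fun h => by simpa using Finset.mem_powerset.1 hS h]
  rfl

/-- The estimator is unbiased: the expected value at a root is the reward of this edge. -/
theorem expected_coeff (a : Fin m) :
    expected (fun a (l : List (Fin m)) => coeff η T (ends a) (l.map ends)) a =
      reward η T (List.ofFn ends) (ends a) := by
  have hn : ((Finset.univ.erase a).toList : List (Fin m)).Nodup := Finset.nodup_toList _
  have h1 := sum_map_sublists' (fun l => coeff η T (ends a) (l.map ends)) hn
  rw [Finset.toList_toFinset] at h1
  have h2 : ∀ S ∈ (Finset.univ.erase a : Finset (Fin m)).powerset,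
      coeff η T (ends a) (S.toList.map ends) =
      coeff η T (ends a) ((((Finset.univ.erase a).toList).filter (· ∈ S)).map ends) := by
    intro S hS
    refine coeff_perm _ (List.Perm.map _ ?_)
    refine (List.perm_ext_iff_of_nodup S.nodup_toList (hn.filter _)).2 fun x => ?_
    simp only [Finset.mem_toList, List.mem_filter, decide_eq_true_eq]
    exact ⟨fun h => ⟨Finset.mem_powerset.1 hS h, h⟩, fun h => h.2⟩
  rw [expected, Finset.sum_congr rfl h2, ← h1]
  have h3 := sum_coeff (η := η) (T := T) (ends a) ((Finset.univ.erase a).toList.map ends)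
  rw [List.sublists'_map, List.map_map] at h3
  refine Eq.trans h3 (reward_perm ?_ _)
  rw [← List.map_cons, List.ofFn_eq_map]
  refine List.Perm.map _ ((List.perm_ext_iff_of_nodup ?_ (List.nodup_finRange m)).2 fun x => ?_)
  · exact List.nodup_cons.2 ⟨by simp, hn⟩
  · simp [em]

theorem meanReward_ofFn (σ : Perm (Fin m)) :
    meanReward η T ((List.ofFn σ).map ends) =
      (∑ a, reward η T (List.ofFn ends) (ends a)) / m := by
  rw [meanReward, List.length_map, List.length_ofFn, Finset.sum_range]
  congr 1
  rw [← Equiv.sum_comp σ fun a => reward η T (List.ofFn ends) (ends a)]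
  refine Finset.sum_congr rfl fun i _ => ?_
  rw [probe_ofFn]
  refine reward_perm ?_ _
  rw [← List.map_cons]
  refine ((perm_cons_eraseIdx σ i).map ends).trans ?_
  rw [List.map_ofFn]
  exact σ.ofFn_comp_perm ends

theorem card_touches_le {D : ℕ}
    (hdeg : ∀ v, (Finset.univ.filter fun a => (ends a).1 = v).card +
      (Finset.univ.filter fun a => (ends a).2 = v).card ≤ D) (c : Fin m) :
    (open Classical in Finset.univ.filter fun b => Touches (ends c) (ends b)).card ≤ 2 * D := by
  classical
  have hsub : (Finset.univ.filter fun b => Touches (ends c) (ends b)) ⊆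
      ((Finset.univ.filter fun a => (ends a).1 = (ends c).1) ∪
        (Finset.univ.filter fun a => (ends a).2 = (ends c).1)) ∪
      ((Finset.univ.filter fun a => (ends a).1 = (ends c).2) ∪
        (Finset.univ.filter fun a => (ends a).2 = (ends c).2)) := by
    intro b hb
    simp only [Finset.mem_union, Finset.mem_filter, Finset.mem_univ, true_and]
    rcases (Finset.mem_filter.1 hb).2 with h | h | h | h
    exacts [.inl (.inl h.symm), .inl (.inr h.symm), .inr (.inl h.symm), .inr (.inr h.symm)]
  have h1 := (Finset.card_union_le _ _).trans (hdeg (ends c).1)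
  have h2 := (Finset.card_union_le _ _).trans (hdeg (ends c).2)
  rw [two_mul]
  exact (Finset.card_le_card hsub).trans ((Finset.card_union_le _ _).trans (Nat.add_le_add h1 h2))

theorem abs_observed_le (nb : Fin m → Finset (Fin m)) (hnb : ∀ a, (nb a).card ≤ L)
    (hw : ∀ a (l : List (Fin m)), weight η T L (ends a) (l.map ends) ≠ 0 → ∀ y ∈ l, y ∈ nb a)
    (a : Fin m) (σ : Perm (Fin m)) :
    |observed (fun a (l : List (Fin m)) => weight η T L (ends a) (l.map ends)) a σ| ≤
      2 ^ L * (2 ^ L * L.factorial) := by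
  have h1 : observed (fun a (l : List (Fin m)) => weight η T L (ends a) (l.map ends)) a σ =
      ∑ S ∈ (Finset.univ.erase a).powerset.filter (· ⊆ nb a),
        weight η T L (ends a) ((order σ S).map ends) := by
    refine (Finset.sum_filter_of_ne fun S _ hne => ?_).symm
    intro y hy
    exact hw a _ hne y (mem_order.2 hy)
  rw [h1]
  refine (Finset.abs_sum_le_sum_abs _ _).trans
    ((Finset.sum_le_card_nsmul _ _ _ fun S _ => abs_weight_le _ _).trans ?_)
  rw [nsmul_eq_mul]
  refine mul_le_mul_of_nonneg_right ?_ (by positivity)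
  have h2 : ((Finset.univ.erase a).powerset.filter (· ⊆ nb a)).card ≤ 2 ^ (nb a).card := by
    rw [← Finset.card_powerset]
    exact Finset.card_le_card fun S hS => Finset.mem_powerset.2 (Finset.mem_filter.1 hS).2
  exact_mod_cast h2.trans (Nat.pow_le_pow_right (by norm_num) (hnb a))

/-- The estimate is close to the average reward for all but one percent of the orders. -/
theorem card_estimate_deviation_le {D : ℕ}
    (hdeg : ∀ v, (Finset.univ.filter fun a => (ends a).1 = v).card +
      (Finset.univ.filter fun a => (ends a).2 = v).card ≤ D)
    (hL : L = (2 * D) ^ (T + 1)) {s : ℕ} (hs : 2 ≤ s) {δ : ℚ} (hδ : 0 < δ)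
    (hsδ : 100 * ((2 ^ L * (2 ^ L * L.factorial)) ^ 2 *
      (4 + 16 * ((2 * D) ^ (2 * (T + 1)) : ℕ))) ≤ s * δ ^ 2) :
    100 * (((Finset.univ : Finset (Perm (Fin m))).filter fun σ : Perm (Fin m) =>
      δ < |estimate η T L s ((List.ofFn σ).map ends) -
        (∑ a, reward η T (List.ofFn ends) (ends a)) / m|).card : ℚ) ≤ m.factorial := by
  classical
  rcases lt_or_ge m s with hms | hms
  · have h0 : ((Finset.univ : Finset (Perm (Fin m))).filter fun σ : Perm (Fin m) =>
        δ < |estimate η T L s ((List.ofFn σ).map ends) -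
          (∑ a, reward η T (List.ofFn ends) (ends a)) / m|) = ∅ := by
      refine Finset.filter_eq_empty_iff.2 fun σ _ => ?_
      rw [estimate, if_pos (by simpa using hms), meanReward_ofFn, sub_self, abs_zero]
      exact not_lt.2 hδ.le
    rw [h0]
    simp
  have hm0 : (m : ℚ) ≠ 0 := by exact_mod_cast (by omega : m ≠ 0)
  -- a sequence with a nonzero coefficient lies in `nb a`, whence its length is at most `L`
  set nb : Fin m → Finset (Fin m) := fun a => Finset.univ.filter fun b => Near ends (T + 1) a b
    with hnb
  have htouch := card_touches_le hdeg
  have hcard : ∀ a, (nb a).card ≤ L := fun a => hL ▸ card_near_le htouch (T + 1) a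
  have hh : ∀ a (l : List (Fin m)), coeff η T (ends a) (l.map ends) ≠ 0 →
      ∀ y ∈ l, y ∈ nb a := fun a l hne y hy =>
    Finset.mem_filter.2 ⟨Finset.mem_univ _, near_of_coeff_ne_zero hne y hy⟩
  have hw : ∀ a (l : List (Fin m)), weight η T L (ends a) (l.map ends) ≠ 0 →
      ∀ y ∈ l, y ∈ nb a := fun a l hne =>
    hh a l (coeff_ne_zero_of_weight_ne_zero hne)
  have havg : ∀ a (l : List (Fin m)), l.Nodup →
      (l.permutations.map fun l : List (Fin m) => weight η T L (ends a) (l.map ends)).sum =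
        l.length.factorial * coeff η T (ends a) (l.map ends) := by
    intro a l hl
    have h1 := sum_weight_permutations (η := η) (T := T) (L := L) (a := ends a)
      (l := l.map ends) fun hne => by
        rw [List.length_map, ← List.toFinset_card_of_nodup hl]
        exact (Finset.card_le_card fun y hy => hh a l hne y (List.mem_toFinset.1 hy)).trans
          (hcard a)
    rw [← List.map_permutations, List.map_map, List.length_map] at h1
    exact h1
  have hself : ∀ a, a ∈ nb a := fun a =>
    Finset.mem_filter.2 ⟨Finset.mem_univ _, Near.mono (Nat.zero_le _) rfl⟩
  have hB : ∀ a, (Finset.univ.filter fun b => ¬ Disjoint (nb a) (nb b)).card ≤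
      (2 * D) ^ (2 * (T + 1)) := by
    intro a
    refine (Finset.card_le_card fun b hb => ?_).trans (card_near_le htouch (2 * (T + 1)) a)
    obtain ⟨y, hy, hy'⟩ := Finset.not_disjoint_iff.1 (Finset.mem_filter.1 hb).2
    refine Finset.mem_filter.2 ⟨Finset.mem_univ _, ?_⟩
    rw [two_mul]
    exact (Finset.mem_filter.1 hy).2.trans (Finset.mem_filter.1 hy').2.symm
  have hM1 : (1 : ℚ) ≤ 2 ^ L * (2 ^ L * L.factorial) := by
    exact_mod_cast Nat.one_le_iff_ne_zero.2 (by positivity)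
  set I : Finset (Fin m) := Finset.univ.map (Fin.castLEEmb hms) with hI
  have hIs : I.card = s := by simp [hI]
  have key := card_deviation_le
    (w := fun a (l : List (Fin m)) => weight η T L (ends a) (l.map ends))
    (h := fun a (l : List (Fin m)) => coeff η T (ends a) (l.map ends)) hw hh havg hself
    (abs_observed_le nb hcard hw)
    (fun a => by rw [expected_coeff]; exact (abs_reward_le_one _ _).trans hM1) hB
    (μ := (∑ a, reward η T (List.ofFn ends) (ends a)) / m)
    (by simp only [expected_coeff]; field_simp) hδ (I := I) (by rwa [hIs])
    (by rw [hIs]; exact hsδ)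
  refine le_trans (le_of_eq ?_) key
  congr 3
  refine Finset.filter_congr fun σ _ => ?_
  rw [estimate, if_neg (by simpa using hms), hIs, Finset.sum_range, hI, Finset.sum_map]
  simp only [Fin.coe_castLEEmb, ← probe_totalWeight, Fin.val_castLE]

end Accuracy

/-! ### The edge filter -/

section Filter

open Equiv (Perm)

/-- There is an edge filter with bounded memory whose output, for all but one percent of the
orders, approximates the maximum cut density `k / m`. -/
theorem exists_filter (D : ℕ) {ε : ℚ} (hε : 0 < ε) :
    ∃ (K : ℕ) (keep : List (ℕ × ℕ) → ℕ × ℕ → Prop) (out : List (ℕ × ℕ) → ℚ),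
      (∀ l e, keep l e → l.length < K) ∧
      (∀ φ : ℕ → ℕ, Function.Injective φ → ∀ l e,
        keep (l.map (relabel φ)) (relabel φ e) ↔ keep l e) ∧
      (∀ φ : ℕ → ℕ, Function.Injective φ → ∀ l, out (l.map (relabel φ)) = out l) ∧
      (∀ l, 0 ≤ out l) ∧
      ∀ (m : ℕ) (ends : Fin m → ℕ × ℕ), 0 < m → (∀ a, (ends a).1 ≠ (ends a).2) →
        (∀ v, (Finset.univ.filter fun a => (ends a).1 = v).card +
          (Finset.univ.filter fun a => (ends a).2 = v).card ≤ D) →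
        ∀ k : ℚ, (∀ x, (cutCount ends x : ℚ) ≤ k) → (∃ x, (cutCount ends x : ℚ) = k) →
          100 * (((Finset.univ : Finset (Perm (Fin m))).filter fun σ : Perm (Fin m) =>
            ¬ ((1 / 2 - ε) * (k / m) ≤ out (retain keep ((List.ofFn σ).map ends)) ∧
              out (retain keep ((List.ofFn σ).map ends)) ≤ k / m)).card : ℚ) ≤ m.factorial := by
  -- with these `η` and `T` the regret `1 / (η T) + η D / 2` is at most `ε / 4`; estimating up to
  -- `δ = ε / 8` then keeps the total error at most `ε / 4`, hence at most `ε` times the maximum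
  set η : ℚ := ε / (4 * (D + 1)) with hη
  have hη0 : 0 < η := by positivity
  obtain ⟨T, hT⟩ := exists_nat_gt (8 / (ε * η))
  have hT0 : (0 : ℚ) < T := lt_of_le_of_lt (by positivity) hT
  set δ : ℚ := ε / 8 with hδ
  have hδ0 : 0 < δ := by positivity
  set L : ℕ := (2 * D) ^ (T + 1) with hL
  obtain ⟨s₀, hs₀⟩ := exists_nat_gt (100 * ((2 ^ L * (2 ^ L * (L.factorial : ℚ))) ^ 2 *
      (4 + 16 * ((2 * D) ^ (2 * (T + 1)) : ℕ))) / δ ^ 2)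
  set s : ℕ := s₀ + 2 with hs
  have hsδ : 100 * ((2 ^ L * (2 ^ L * (L.factorial : ℚ))) ^ 2 *
      (4 + 16 * ((2 * D) ^ (2 * (T + 1)) : ℕ))) ≤ s * δ ^ 2 := by
    rw [← div_le_iff₀ (by positivity)]
    refine hs₀.le.trans ?_
    exact_mod_cast (by omega : s₀ ≤ s)
  set K : ℕ := s * (2 * D) ^ L + s + 1 with hK
  -- the estimate can be as large as twice the maximum plus `δ`, so it is lowered by `δ` and halved
  refine ⟨K, Keep L s K, fun l => max 0 (estimate η T L s l / 2 - δ / 2), fun l e h => h.1,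
    fun φ hφ l e => keep_relabel hφ l e, fun φ hφ l => by simp only [estimate_relabel hφ],
    fun l => le_max_left _ _, ?_⟩
  intro m ends hm hloop hdeg k hk ⟨x, hx⟩
  have hm0 : (0 : ℚ) < m := by exact_mod_cast hm
  have hretain : ∀ σ : Perm (Fin m), estimate η T L s (retain (Keep L s K)
      ((List.ofFn σ).map ends)) = estimate η T L s ((List.ofFn σ).map ends) := fun σ =>
    estimate_retain _ fun p hp => length_retain_lt (card_touches_le hdeg) (by omega)
      (List.nodup_ofFn.2 σ.injective) hp
  refine le_trans ?_ (card_estimate_deviation_le (η := η) (T := T) hdeg hL (by omega) hδ0 hsδ)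
  refine mul_le_mul_of_nonneg_left ?_ (by norm_num)
  refine Nat.cast_le.2 (Finset.card_le_card fun σ hσ => ?_)
  rw [Finset.mem_filter] at hσ ⊢
  refine ⟨Finset.mem_univ _, ?_⟩
  by_contra hle
  refine hσ.2 ?_
  rw [not_lt, abs_le] at hle
  dsimp only
  rw [hretain]
  set μ : ℚ := (∑ a, reward η T (List.ofFn ends) (ends a)) / m with hμ
  set est := estimate η T L s ((List.ofFn σ).map ends) with hest
  have hupper : μ ≤ 2 * (k / m) := by
    rw [hμ, div_le_iff₀ hm0]
    refine (sum_reward_le (by exact_mod_cast hT0) hloop hk).trans (le_of_eq ?_)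
    field_simp
  have hquarter : 1 / 4 ≤ k / m := by
    rw [le_div_iff₀ hm0]
    linarith [card_div_four_le hloop hk]
  have hgap : 1 / (η * T) + η * D / 2 ≤ ε / 4 := by
    have h1 : 1 / (η * T) ≤ ε / 8 := by
      rw [div_lt_iff₀ (by positivity)] at hT
      rw [div_le_iff₀ (by positivity)]
      linarith
    have h2 : η * D / 2 ≤ ε / 8 := by
      rw [hη, div_mul_eq_mul_div, div_div, div_le_div_iff₀ (by positivity) (by positivity)]
      nlinarith
    linarith
  have hlower : k / m ≤ μ + ε / 4 := by
    have h1 := cutCount_le_sum_reward (T := T) (by exact_mod_cast hT0) hη0 hdeg x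
    rw [hx] at h1
    rw [div_le_iff₀ hm0, hμ, add_mul, div_mul_cancel₀ _ hm0.ne']
    nlinarith
  constructor
  · refine le_trans ?_ (le_max_right _ _)
    nlinarith
  · refine max_le (by linarith) (by linarith)

end Filter

/-! ### Orderings of the edge multiset -/

section Orderings

open Equiv (Perm)

theorem sum_get_eq_countP {α : Type} (l : List α) (p : α → Prop) [DecidablePred p] :
    (Finset.univ.filter fun a : Fin l.length => p (l.get a)).card = l.countP p := by
  rw [Finset.card_filter]
  induction l with
  | nil => simp
  | cons x l ih =>
    have h := Fin.sum_univ_succ fun a : Fin (l.length + 1) =>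
      if p ((x :: l).get a) then 1 else 0
    rw [List.countP_cons, ← ih]
    refine h.trans ?_
    by_cases hx : p x <;> simp [hx, add_comm]

theorem sum_count_mk_right {α : Type} [Fintype α] [DecidableEq α] (v : α) (l : List (α × α)) :
    ∑ u, (l : Multiset (α × α)).count (v, u) = l.countP fun y => y.1 = v := by
  induction l with
  | nil => simp
  | cons y l ih =>
    simp only [← Multiset.cons_coe, Multiset.count_cons, List.countP_cons,
      Finset.sum_add_distrib, ih]
    congr 1
    obtain ⟨a, b⟩ := y
    by_cases h : a = v
    · simp [h]
    · simp [h, Ne.symm h]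

theorem sum_count_mk_left {α : Type} [Fintype α] [DecidableEq α] (v : α) (l : List (α × α)) :
    ∑ u, (l : Multiset (α × α)).count (u, v) = l.countP fun y => y.2 = v := by
  induction l with
  | nil => simp
  | cons y l ih =>
    simp only [← Multiset.cons_coe, Multiset.count_cons, List.countP_cons,
      Finset.sum_add_distrib, ih]
    congr 1
    obtain ⟨a, b⟩ := y
    by_cases h : b = v
    · simp [h]
    · simp [h, Ne.symm h]

theorem exists_perm_ofFn {α : Type} {l l' : List α} (h : l'.Perm l) :
    ∃ σ : Perm (Fin l.length), List.ofFn (l.get ∘ σ) = l' := by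
  have h1 : l' ∈ ((List.finRange l.length).map l.get).permutations := by
    rw [List.mem_permutations, ← List.ofFn_eq_map, List.ofFn_get]
    exact h
  rw [← List.map_permutations, List.mem_map] at h1
  obtain ⟨r, hr, rfl⟩ := h1
  rw [List.mem_permutations] at hr
  have hlen : r.length = l.length := by rw [hr.length_eq, List.length_finRange]
  have hinj : Function.Injective fun i : Fin l.length => r.get (i.cast hlen.symm) := by
    intro i j hij
    have := (List.nodup_iff_injective_get.1 (hr.nodup_iff.2 (List.nodup_finRange _))) hij
    simpa using this
  refine ⟨Equiv.ofBijective _ (Finite.injective_iff_bijective.1 hinj), ?_⟩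
  refine List.ext_get (by simp [hlen]) fun i h₁ h₂ => ?_
  simp

/-- A uniformly random permutation of the labels induces a uniformly random ordering of the edge
multiset. -/
theorem card_perm_mul_card_orderings {V : Type} [DecidableEq V] (G : DiMultigraph V)
    {l₀ : List (V × V)} (hl₀ : (l₀ : Multiset (V × V)) = G.edges) (Q : List (V × V) → Prop)
    [DecidablePred Q] :
    ((Finset.univ : Finset (Perm (Fin l₀.length))).filter
        fun σ : Perm (Fin l₀.length) => Q (List.ofFn (l₀.get ∘ σ))).card * G.orderings.card =
      (G.orderings.filter Q).card * l₀.length.factorial := by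
  have hmem : ∀ σ : Perm (Fin l₀.length), List.ofFn (l₀.get ∘ σ) ∈ G.orderings := by
    intro σ
    rw [DiMultigraph.mem_orderings, ← hl₀, Multiset.coe_eq_coe]
    refine (σ.ofFn_comp_perm l₀.get).trans ?_
    rw [List.ofFn_get]
  set c := ((Finset.univ : Finset (Perm (Fin l₀.length))).filter
    fun τ : Perm (Fin l₀.length) => l₀.get ∘ τ = l₀.get).card with hc
  -- all fibres are cosets of the group of permutations that only exchange parallel edges
  have hfib : ∀ l ∈ G.orderings, ((Finset.univ : Finset (Perm (Fin l₀.length))).filter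
      fun σ : Perm (Fin l₀.length) => List.ofFn (l₀.get ∘ σ) = l).card = c := by
    intro l hl
    rw [DiMultigraph.mem_orderings, ← hl₀, Multiset.coe_eq_coe] at hl
    obtain ⟨σ₀, rfl⟩ := exists_perm_ofFn hl
    rw [hc]
    refine (Finset.card_bij (fun τ _ => τ * σ₀) (fun τ hτ => ?_) (fun τ _ τ' _ h => ?_)
      fun σ hσ => ⟨σ * σ₀⁻¹, ?_, by simp⟩).symm
    · rw [Finset.mem_filter] at hτ ⊢
      refine ⟨Finset.mem_univ _, congrArg List.ofFn ?_⟩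
      rw [Perm.coe_mul, ← Function.comp_assoc, hτ.2]
    · exact mul_right_cancel h
    · rw [Finset.mem_filter] at hσ ⊢
      refine ⟨Finset.mem_univ _, ?_⟩
      have h := List.ofFn_injective hσ.2
      rw [Perm.coe_mul, ← Function.comp_assoc, h, Function.comp_assoc, ← Perm.coe_mul]
      simp
  have hcount : ∀ (Q : List (V × V) → Prop) [DecidablePred Q],
      ((Finset.univ : Finset (Perm (Fin l₀.length))).filter
      fun σ : Perm (Fin l₀.length) => Q (List.ofFn (l₀.get ∘ σ))).card =
        (G.orderings.filter Q).card * c := by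
    intro Q _
    rw [Finset.card_eq_sum_card_fiberwise (f := fun σ : Perm (Fin l₀.length) =>
      List.ofFn (l₀.get ∘ σ)) (t := G.orderings.filter Q)
      fun σ hσ => by simpa [hmem] using hσ]
    refine (Finset.sum_congr rfl fun l hl => ?_).trans (by rw [Finset.sum_const, smul_eq_mul])
    rw [Finset.mem_filter] at hl
    rw [← hfib l hl.1, Finset.filter_filter]
    congr 1
    refine Finset.filter_congr fun σ _ => ?_
    constructor
    · exact fun h => h.2
    · exact fun h => ⟨h ▸ hl.2, h⟩
  have htotal := hcount fun _ => True
  simp only [Finset.filter_true, Finset.card_univ, Fintype.card_perm, Fintype.card_fin] at htotal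
  rw [hcount Q, htotal]
  ring

end Orderings

/-! ### From multigraphs to labelled edges -/

section Labels

variable {n : ℕ} (l : List (Fin n × Fin n))

/-- The endpoints of the edges in a list, as natural numbers. -/
def endpoints (a : Fin l.length) : ℕ × ℕ := ((l.get a).1, (l.get a).2)

theorem encode_ofFn (σ : Equiv.Perm (Fin l.length)) :
    StreamAlg.encode (List.ofFn (l.get ∘ σ)) = (List.ofFn σ).map (endpoints l) := by
  rw [StreamAlg.encode, List.map_ofFn, List.map_ofFn]
  rfl

variable {l} {G : DiMultigraph (Fin n)} (hl : (l : Multiset (Fin n × Fin n)) = G.edges)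
include hl

theorem card_incident_le {D : ℕ} (hG : G.MaxDegreeLE D) (v : ℕ) :
    (Finset.univ.filter fun a => (endpoints l a).1 = v).card +
      (Finset.univ.filter fun a => (endpoints l a).2 = v).card ≤ D := by
  by_cases hv : v < n
  · have h := hG ⟨v, hv⟩
    rw [DiMultigraph.degree, DiMultigraph.outDegree, DiMultigraph.inDegree, ← hl] at h
    rw [sum_count_mk_right, sum_count_mk_left, ← sum_get_eq_countP, ← sum_get_eq_countP] at h
    refine le_trans (le_of_eq ?_) h
    congr 2 <;> exact Finset.filter_congr fun a _ => by simp [endpoints, Fin.ext_iff]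
  · have h1 : ∀ a, (endpoints l a).1 ≠ v := fun a h => hv (h ▸ (l.get a).1.2)
    have h2 : ∀ a, (endpoints l a).2 ≠ v := fun a h => hv (h ▸ (l.get a).2.2)
    simp [h1, h2]

theorem cutValue_eq (x : Fin n → Bool) (y : ℕ → Bool) (hxy : ∀ v : Fin n, y v = x v) :
    G.cutValue x = (cutCount (endpoints l) y : ℝ) / l.length := by
  rw [DiMultigraph.cutValue, ← hl, Multiset.coe_countP, Multiset.coe_card, ← sum_get_eq_countP,
    cutCount]
  simp only [endpoints, hxy]

/-- The maximum directed cut, in terms of labelled edges. -/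
theorem exists_cutCount_eq :
    ∃ k : ℕ, G.maxDicut = (k : ℝ) / l.length ∧ (∀ y, cutCount (endpoints l) y ≤ k) ∧
      ∃ y, cutCount (endpoints l) y = k := by
  obtain ⟨x, -, hx⟩ := Finset.exists_mem_eq_sup' (Finset.univ_nonempty (α := Fin n → Bool))
    G.cutValue
  set y : ℕ → Bool := fun v => if h : v < n then x ⟨v, h⟩ else false with hy
  have hmax : G.maxDicut = (cutCount (endpoints l) y : ℝ) / l.length :=
    hx.trans (cutValue_eq hl x y fun v => by simp [hy])
  refine ⟨_, hmax, fun y' => ?_, y, rfl⟩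
  rcases Nat.eq_zero_or_pos l.length with h0 | h0
  · have : ∀ y' : ℕ → Bool, cutCount (endpoints l) y' ≤ 0 := fun y' => by
      rw [← h0]
      simpa [cutCount] using
        Finset.card_filter_le (Finset.univ : Finset (Fin l.length)) _
    exact (this y').trans (Nat.zero_le _)
  · have h1 : G.cutValue (fun v => y' v) ≤ G.maxDicut :=
      Finset.le_sup' G.cutValue (Finset.mem_univ _)
    rw [hmax, cutValue_eq hl _ y' fun _ => rfl,
      div_le_div_iff_of_pos_right (by exact_mod_cast h0)] at h1
    exact_mod_cast h1

end Labels

end RandomOrderDicut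

open RandomOrderDicut in
theorem theorem2 (D : ℕ) (ε : ℝ) (hε : 0 < ε) :
    ∃ (A : StreamAlg) (C : ℝ), ∀ (n : ℕ) (G : DiMultigraph (Fin n)),
      G.edges ≠ 0 → G.MaxDegreeLE D →
        A.UsesSpaceAtMost G (C * Real.log n) ∧
        ∃ T : ℕ, A.HaltsWithin G T ∧
          99 / 100 ≤ A.randomOrderProb G T (fun q =>
            (1 / 2 - ε) * G.maxDicut ≤ (q : ℝ) ∧ (q : ℝ) ≤ G.maxDicut) := by
  classical
  obtain ⟨ε', hε'0, hε'⟩ := exists_rat_btwn hε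
  obtain ⟨K, keep, out, hcap, hkeep, hout, hnn, hacc⟩ :=
    exists_filter D (ε := ε') (by exact_mod_cast hε'0)
  obtain ⟨A, C, hA⟩ := EdgeFilter.exists_streamAlg K keep out hcap hkeep hout hnn
  refine ⟨A, C, fun n G hG hdeg => ?_⟩
  obtain ⟨l₀, hl₀⟩ : ∃ l₀ : List (Fin n × Fin n), (l₀ : Multiset (Fin n × Fin n)) = G.edges :=
    ⟨_, G.edges.coe_toList⟩
  have hm : 0 < l₀.length := by
    refine List.length_pos_of_ne_nil fun h => hG ?_
    rw [← hl₀, h]; rfl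
  have hloop : ∀ a, (endpoints l₀ a).1 ≠ (endpoints l₀ a).2 := fun a h =>
    G.loopless (l₀.get a) (by rw [← hl₀]; exact List.get_mem _ _) (Fin.ext h)
  -- there is an edge and it is not a loop; this makes `log n` positive
  have hn : 2 ≤ n := by
    have h1 := hloop ⟨0, hm⟩
    have h2 := (l₀.get ⟨0, hm⟩).1.2
    have h3 := (l₀.get ⟨0, hm⟩).2.2
    simp only [endpoints] at h1
    omega
  have hstream : ∀ l : List (Fin n × Fin n), ∀ e ∈ StreamAlg.encode l, e.1 < n ∧ e.2 < n := by
    intro l e he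
    obtain ⟨f, -, rfl⟩ := List.mem_map.1 he
    exact ⟨f.1.2, f.2.2⟩
  refine ⟨fun l _ coins => (hA n hn _ (hstream l)).1 coins, ?_⟩
  choose t ht using fun l : List (Fin n × Fin n) => (hA n hn _ (hstream l)).2
  set T := G.orderings.sup t with hT
  have houtput : ∀ l ∈ G.orderings, ∀ coins : Fin T → Bool,
      A.output (A.run n (StreamAlg.encode l) (List.ofFn coins)) =
        some (out (retain keep (StreamAlg.encode l))) := fun l hl coins =>
    ht l _ (by rw [List.length_ofFn]; exact Finset.le_sup hl)
  refine ⟨T, fun l hl coins => by rw [houtput l hl coins]; rfl, ?_⟩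
  obtain ⟨k, hk, hk1, hk2⟩ := exists_cutCount_eq hl₀
  have hdev := hacc l₀.length (endpoints l₀) hm hloop (card_incident_le hl₀ hdeg) k
    (fun y => by exact_mod_cast hk1 y) (hk2.imp fun y hy => by exact_mod_cast hy)
  set good : List (Fin n × Fin n) → Prop := fun l =>
    (1 / 2 - ε') * ((k : ℚ) / l₀.length) ≤ out (retain keep (StreamAlg.encode l)) ∧
      out (retain keep (StreamAlg.encode l)) ≤ (k : ℚ) / l₀.length with hgood
  have hbad : 100 * (G.orderings.filter fun l => ¬ good l).card ≤ G.orderings.card := by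
    have h1 := card_perm_mul_card_orderings G hl₀ fun l => ¬ good l
    have h2 : 100 * ((Finset.univ : Finset (Equiv.Perm (Fin l₀.length))).filter
        fun σ : Equiv.Perm (Fin l₀.length) => ¬ good (List.ofFn (l₀.get ∘ σ))).card ≤
          l₀.length.factorial := by
      simp only [hgood, encode_ofFn]
      exact_mod_cast hdev
    refine Nat.le_of_mul_le_mul_right (c := l₀.length.factorial) ?_ (Nat.factorial_pos _)
    calc _ = 100 * ((G.orderings.filter fun l => ¬ good l).card * l₀.length.factorial) := by ring
      _ = _ * G.orderings.card := by rw [← h1]; ring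
      _ ≤ l₀.length.factorial * G.orderings.card := Nat.mul_le_mul_right _ h2
      _ = _ := by ring
  -- the coins do not matter: a good ordering succeeds with all of them
  have hprod : (G.orderings.filter good) ×ˢ (Finset.univ : Finset (Fin T → Bool)) ⊆
      (G.orderings ×ˢ (Finset.univ : Finset (Fin T → Bool))).filter fun p =>
        ∃ q, A.output (A.run n (StreamAlg.encode p.1) (List.ofFn p.2)) = some q ∧
          ((1 / 2 - ε) * G.maxDicut ≤ (q : ℝ) ∧ (q : ℝ) ≤ G.maxDicut) := by
    intro p hp
    obtain ⟨hp1, hp2⟩ := Finset.mem_filter.1 (Finset.mem_product.1 hp).1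
    refine Finset.mem_filter.2 ⟨Finset.mem_product.2 ⟨hp1, Finset.mem_univ _⟩, _,
      houtput _ hp1 _, ?_⟩
    rw [hk]
    have h1 : (1 / 2 - (ε' : ℝ)) * ((k : ℝ) / l₀.length) ≤
        (out (retain keep (StreamAlg.encode p.1)) : ℝ) := by
      have h := (Rat.cast_le (K := ℝ)).2 hp2.1
      push_cast at h
      exact h
    have h2 : (out (retain keep (StreamAlg.encode p.1)) : ℝ) ≤ (k : ℝ) / l₀.length := by
      have h := (Rat.cast_le (K := ℝ)).2 hp2.2
      push_cast at h
      exact h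
    have h3 : (0 : ℝ) ≤ (k : ℝ) / l₀.length := by positivity
    exact ⟨le_trans (mul_le_mul_of_nonneg_right (by linarith) h3) h1, h2⟩
  have hord : 0 < G.orderings.card :=
    Finset.card_pos.2 ⟨l₀, (G.mem_orderings l₀).2 hl₀⟩
  have hsplit := Finset.card_filter_add_card_filter_not (s := G.orderings) good
  have hgoodcard : (99 : ℝ) / 100 * G.orderings.card ≤ (G.orderings.filter good).card := by
    have h1 : 99 * G.orderings.card ≤ 100 * (G.orderings.filter good).card := by omega
    have h2 : (99 : ℝ) * G.orderings.card ≤ 100 * (G.orderings.filter good).card := by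
      exact_mod_cast h1
    linarith
  have hcard := Finset.card_le_card hprod
  rw [Finset.card_product] at hcard
  unfold StreamAlg.randomOrderProb
  have hcoins : (0 : ℝ) < ((Finset.univ : Finset (Fin T → Bool)).card : ℝ) := by
    exact_mod_cast Finset.card_pos.2 Finset.univ_nonempty
  have hord' : (0 : ℝ) < (G.orderings.card : ℝ) := by exact_mod_cast hord
  rw [Finset.card_product, Nat.cast_mul, le_div_iff₀ (by positivity), ← mul_assoc]
  refine le_trans (mul_le_mul_of_nonneg_right hgoodcard hcoins.le) ?_
  refine le_trans ?_ (Nat.cast_le.2 (hcard.trans (le_of_eq ?_)))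
  · push_cast; exact le_refl _
  · congr!
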